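/- Let $\mathbb O$ be a monster model of a complete first-order theory $T$ in a language $L$: for some cardinal $\kappa>|L|+\aleph_0$, $\mathbb O$ is $\kappa$-saturated and strongly $\kappa$-homogeneous. Let $A\subseteq\mathbb O$ be a small set, $|A|<\kappa$. Tuples of variables may be finite or infinite, and of any length. $S_{\bar x}(A)$ is the space of complete types over $A$ in the variables $\bar x$. A global type is an element $p(\bar x)$ of $S_{\bar x}(\mathbb O)$; it is $A$-invariant if it is fixed by $\mathrm{Aut}(\mathbb O/A)$, and an $A$-coheir if it is finitely satisfiable in $A$. $A$ is an invariance base if every type over $A$ extends to a global $A$-invariant type. A sequence $(b_i)_{i<n}$ of tuples is an invariant sequence over $A$ if $b_i\equiv_A b_j$ for all $i,j<n$ and, for each $i<n$, $\mathrm{tp}(b_i/Ab_{<i})$ extends to a global $A$-invariant type. (For tuples too long to be realized in $\mathbb O$, a type over $A$ is called the type of an invariant sequence if its restriction to each finite subtuple $\bar x'$ of the variables $\bar x$ of the terms of the sequence, the same $\bar x'$ for each term, is the type of an invariant sequence in $\mathbb O$.) Given a class $\mathcal I$ of $A$-invariant types, a type is reliably in $\mathcal I$ if it belongs to the largest class $\mathcal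 R\subseteq\mathcal I$ such that 1. if $p(\bar x,\bar y)\in\mathcal R$, then its restriction to $\bar x$ is in $\mathcal R$; 2. if $p(\bar x)\in\mathcal R$ and $q(\bar x,\bar y)\in S(A)$ extends $p{\upharpoonright}A$, then some $r(\bar x,\bar y)\in\mathcal R$ extends $p(\bar x)\cup q(\bar x,\bar y)$; 3. if $p(\bar x_0)\in\mathcal R$ and $q(\bar x_0,\dots,\bar x_{n-1})\in S(A)$, $n\ge 1$, extends $(p{\upharpoonright}A)(\bar x_0)$ and is the type of an invariant sequence over $A$, then some $r(\bar x_0,\dots,\bar x_{n-1})\in\mathcal R$ extends $p(\bar x_0)\cup\dots\cup p(\bar x_{n-1})\cup q(\bar x_0,\dots,\bar x_{n-1})$. (Classes of types are regarded up to renaming of variables in this definition.) A type is reliably $A$-invariant, respectively a reliable $A$-coheir, if it is reliably in the class of all $A$-invariant types, respectively of all $A$-coheirs. A formula $\varphi(x,c)$ Kim-divides over $A$ if there are a global $A$-invariant type $q(y)\supseteq\mathrm{tp}(c/A)$ and a Morley sequence $(e_i)_{i<\omega}$ generated by $q$ over $A$ (that is, $e_i\models q{\upharpoonright}Ae_{<i}$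 for all $i$) with $\{\varphi(x,e_i):i<\omega\}$ inconsistent. A formula Kim-forks over $A$ if it implies a finite disjunction of formulas that Kim-divide over $A$. An $A$-invariant type $p(\bar x)$ is Kim-strictly $A$-invariant if, whenever $a\models p{\upharpoonright}Ab$, no formula in $\mathrm{tp}(b/Aa)$ Kim-forks over $A$. Then the following hold. (a) Let $\mathcal I$ be a class of $A$-invariant types such that every type over $A$ extends to a member of $\mathcal I$; for each tuple of variables $\bar x$, $S_{\bar x}(\mathbb O)\cap\mathcal I$ is closed in $S_{\bar x}(\mathbb O)$; $\mathcal I$ is invariant under renaming variables; and an $A$-invariant type is in $\mathcal I$ if and only if all its restrictions to finitely many variables are in $\mathcal I$. Then for every $q(\bar x)\in S_{\bar x}(A)$ there is an $A$-invariant type $p(\bar x)\supseteq q(\bar x)$ that is reliably in $\mathcal I$. (b) Every reliably $A$-invariant type is Kim-strictly $A$-invariant. (c) If $A$ is an invariance base, then every type over $A$ extends to a reliably $A$-invariant type, which is also Kim-strictly $A$-invariant. (d) If $A$ is a model (the universe of an elementary substructure of $\mathbb O$), then every type over $A$ extends to a reliable $A$-coheir, which is also Kim-strictly $A$-invariant.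 In particular, every type over a model $M$ has a Kim-strictly $M$-invariant extension (Kruckman–Ramsey). -/

import Mathlib

open Cardinal Set FirstOrder

universe u v w x y

namespace ReliableTypes

open FirstOrder.Language FirstOrder.Language.Theory

/-! ### Complete types over sets of parameters and their restrictions -/

section Types

variable {L : FirstOrder.Language.{u, v}}

/-- The preimage of a maximal consistent theory under a map of languages is maximal consistent. -/
theorem isMaximal_preimage {L₁ : FirstOrder.Language.{u, v}} {L₂ : FirstOrder.Language.{x, y}} (g : L₁ →ᴸ L₂)
    {S : L₂.Theory} (hS : S.IsMaximal) :
    Theory.IsMaximal {φ : L₁.Sentence | g.onSentence φ ∈ S} := by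
  refine ⟨?_, fun φ => ?_⟩
  · have h : (g.onTheory {φ : L₁.Sentence | g.onSentence φ ∈ S}).IsSatisfiable := by
      refine hS.1.mono ?_
      rintro _ ⟨φ, hφ, rfl⟩
      exact hφ
    exact Theory.isSatisfiable_of_isSatisfiable_onTheory g h
  · exact hS.mem_or_not_mem (g.onSentence φ)

/-- The restriction `p(x)` of a complete type `p(x, y)` to some of its variables, along the map
`f` of variables: `φ(x) ∈ p.restrictVars f` if and only if `φ(f(x)) ∈ p`. -/
def restrictVars {L : FirstOrder.Language.{u, v}} {T : L.Theory} {α : Type x} {β : Type y} (f : α → β)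
    (p : T.CompleteType β) : T.CompleteType α where
  toTheory := {φ | (L.lhomWithConstantsMap f).onSentence φ ∈ p}
  subset' := by
    rintro _ ⟨φ, hφ, rfl⟩
    have h : (L.lhomWithConstants β).onSentence φ ∈ p := p.subset ⟨φ, hφ, rfl⟩
    have h' : (L.lhomWithConstantsMap f).onSentence ((L.lhomWithConstants α).onSentence φ) =
        (L.lhomWithConstants β).onSentence φ := by
      rw [← LHom.map_constants_comp_sumInl (L := L) (f := f)]
      exact (congrFun (LHom.comp_onBoundedFormula _ _) φ).symm
    change (L.lhomWithConstantsMap f).onSentence ((L.lhomWithConstants α).onSentence φ) ∈ p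
    rw [h']
    exact h
  isMaximal' := isMaximal_preimage _ p.isMaximal

variable (L) {M : Type w} [L.Structure M]

/-- `S_α(A)`: complete types over the parameter set `A` in a tuple of variables indexed by `α`
(computed in the structure `M`). -/
abbrev TypeOver (A : Set M) (α : Type x) := (L[[A]].completeTheory M).CompleteType α

variable (M) in
/-- `S_α(M)`: global types in a tuple of variables indexed by `α`. -/
abbrev GlobalType (α : Type x) := (L.elementaryDiagram M).CompleteType α

variable {L}

/-- `Holds p φ` says that the formula `φ(c, x)` is in the type `p(x)`. In `φ`, variables in `C` are
to be replaced by the corresponding parameters, those in `α` are the variables of the type. -/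
def Holds {C : Type y} {α : Type x} {T : L[[C]].Theory} (p : T.CompleteType α)
    (φ : L.Formula (C ⊕ α)) : Prop :=
  Formula.equivSentence (L := L[[C]]) (BoundedFormula.constantsVarsEquiv.symm φ) ∈ p

/-- `p ↾ A`, the restriction of a global type to the parameter set `A`. -/
def restrictParams (A : Set M) {α : Type x} (p : GlobalType L M α) : TypeOver L A α where
  toTheory := {φ | ((L.lhomWithConstantsMap ((↑) : A → M)).addConstants α).onSentence φ ∈ p}
  subset' := by
    rintro _ ⟨φ, hφ, rfl⟩
    have h1 : (L.lhomWithConstantsMap ((↑) : A → M)).onSentence φ ∈ L.elementaryDiagram M := by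
      have : (LHom.constantsOnMap ((↑) : A → M)).IsExpansionOn M :=
        constantsOnMap_isExpansionOn rfl
      have : (L.lhomWithConstantsMap ((↑) : A → M)).IsExpansionOn M :=
        LHom.sumMap_isExpansionOn _ _ M
      have := (LHom.realize_onSentence M (L.lhomWithConstantsMap ((↑) : A → M)) φ).2 hφ
      exact this
    have h2 : (L[[M]].lhomWithConstants α).onSentence
        ((L.lhomWithConstantsMap ((↑) : A → M)).onSentence φ) ∈ p := p.subset ⟨_, h1, rfl⟩
    have h3 : ((L.lhomWithConstantsMap ((↑) : A → M)).addConstants α).onSentence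
        ((L[[A]].lhomWithConstants α).onSentence φ) =
        (L[[M]].lhomWithConstants α).onSentence
        ((L.lhomWithConstantsMap ((↑) : A → M)).onSentence φ) := by
      have e1 := (congrFun (LHom.comp_onBoundedFormula (n := 0) (α := Empty)
        ((L.lhomWithConstantsMap ((↑) : A → M)).addConstants α) (L[[A]].lhomWithConstants α)) φ)
      have e2 := (congrFun (LHom.comp_onBoundedFormula (n := 0) (α := Empty)
        (L[[M]].lhomWithConstants α) (L.lhomWithConstantsMap ((↑) : A → M))) φ)
      exact e1.symm.trans e2
    change ((L.lhomWithConstantsMap ((↑) : A → M)).addConstants α).onSentence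
        ((L[[A]].lhomWithConstants α).onSentence φ) ∈ p
    rw [h3]
    exact h2
  isMaximal' := isMaximal_preimage _ p.isMaximal

variable (L) in
/-- `tp(a/A)` for a tuple `a` of elements of `M`. -/
def tp [Nonempty M] (A : Set M) {α : Type x} (a : α → M) : TypeOver L A α :=
  (L[[A]].completeTheory M).typeOf a

theorem realize_code {C : Type y} {α : Type x} {N : Type*} [L.Structure N] [L[[C]].Structure N]
    [(L.lhomWithConstants C).IsExpansionOn N] [L[[C]][[α]].Structure N]
    [(L[[C]].lhomWithConstants α).IsExpansionOn N] (φ : L.Formula (C ⊕ α)) :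
    (Formula.equivSentence (L := L[[C]]) (BoundedFormula.constantsVarsEquiv.symm φ)).Realize N ↔
      φ.Realize (Sum.elim (fun c => (L.con c : N)) (fun a => (L[[C]].con a : N))) := by
  rw [Formula.realize_equivSentence]
  unfold Formula.Realize
  rw [← BoundedFormula.realize_constantsVarsEquiv, Equiv.apply_symm_apply]

theorem holds_tp [Nonempty M] (A : Set M) {α : Type x} (a : α → M) (φ : L.Formula (A ⊕ α)) :
    Holds (tp L A a) φ ↔ φ.Realize (Sum.elim (fun c : A => (c : M)) a) := by
  unfold Holds tp
  rw [CompleteType.formula_mem_typeOf]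
  unfold Formula.Realize
  rw [← BoundedFormula.realize_constantsVarsEquiv, Equiv.apply_symm_apply]
  rfl

theorem holds_restrictVars {C : Type w} {α : Type x} {β : Type y} {T : L[[C]].Theory} (f : α → β)
    (p : T.CompleteType β) (φ : L.Formula (C ⊕ α)) :
    Holds (restrictVars f p) φ ↔ Holds p (φ.relabel (Sum.map id f)) := by
  change (L[[C]].lhomWithConstantsMap f).onSentence _ ∈ (p : L[[C]][[β]].Theory) ↔
    _ ∈ (p : L[[C]][[β]].Theory)
  rw [p.isMaximal.mem_iff_models, p.isMaximal.mem_iff_models, models_sentence_iff,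
    models_sentence_iff]
  refine forall_congr' fun N => ?_
  let s1 : L[[C]].Structure N := (L[[C]].lhomWithConstants β).reduct N
  let s0 : L.Structure N := (L.lhomWithConstants C).reduct N
  let s2 : L[[C]][[α]].Structure N := (L[[C]].lhomWithConstantsMap f).reduct N
  have : (L.lhomWithConstants C).IsExpansionOn N := LHom.isExpansionOn_reduct _ _
  have : (L[[C]].lhomWithConstants β).IsExpansionOn N := LHom.isExpansionOn_reduct _ _
  have : (L[[C]].lhomWithConstantsMap f).IsExpansionOn N := LHom.isExpansionOn_reduct _ _
  have : (L[[C]].lhomWithConstants α).IsExpansionOn N := ⟨fun _ _ => rfl, fun _ _ => rfl⟩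
  rw [LHom.realize_onSentence, realize_code, realize_code, Formula.realize_relabel]
  refine iff_of_eq (congrArg _ ?_)
  funext z
  rcases z with z | z
  · rfl
  · change _ = Structure.funMap _ _
    rfl

theorem holds_restrictParams (A : Set M) {α : Type x} (p : GlobalType L M α)
    (φ : L.Formula (A ⊕ α)) :
    Holds (restrictParams A p) φ ↔ Holds p (φ.relabel (Sum.map (fun c : A => (c : M)) id)) := by
  change ((L.lhomWithConstantsMap ((↑) : A → M)).addConstants α).onSentence _ ∈
    (p : L[[M]][[α]].Theory) ↔ _ ∈ (p : L[[M]][[α]].Theory)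
  rw [p.isMaximal.mem_iff_models, p.isMaximal.mem_iff_models, models_sentence_iff,
    models_sentence_iff]
  refine forall_congr' fun N => ?_
  let s1 : L[[M]].Structure N := (L[[M]].lhomWithConstants α).reduct N
  let s0 : L.Structure N := (L.lhomWithConstants M).reduct N
  let s2 : L[[A]].Structure N := (L.lhomWithConstantsMap ((↑) : A → M)).reduct N
  let s3 : L[[A]][[α]].Structure N :=
    ((L.lhomWithConstantsMap ((↑) : A → M)).addConstants α).reduct N
  have : (L.lhomWithConstants M).IsExpansionOn N := LHom.isExpansionOn_reduct _ _
  have : (L[[M]].lhomWithConstants α).IsExpansionOn N := LHom.isExpansionOn_reduct _ _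
  have : ((L.lhomWithConstantsMap ((↑) : A → M)).addConstants α).IsExpansionOn N :=
    LHom.isExpansionOn_reduct _ _
  have : (L.lhomWithConstants A).IsExpansionOn N := ⟨fun _ _ => rfl, fun _ _ => rfl⟩
  have : (L[[A]].lhomWithConstants α).IsExpansionOn N := ⟨fun _ _ => rfl, fun _ _ => rfl⟩
  rw [LHom.realize_onSentence, realize_code, realize_code, Formula.realize_relabel]
  refine iff_of_eq (congrArg _ ?_)
  funext z
  rcases z with z | z
  · rfl
  · rfl

theorem holds_relabel_relabel {C D E : Type*} {α : Type x} {T : L[[C]].Theory}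
    (p : T.CompleteType α) (f : D → E) (g : E → C ⊕ α) (φ : L.Formula D) :
    Holds p ((φ.relabel f).relabel g) ↔ Holds p (φ.relabel (g ∘ f)) := by
  change _ ∈ (p : L[[C]][[α]].Theory) ↔ _ ∈ (p : L[[C]][[α]].Theory)
  rw [p.isMaximal.mem_iff_models, p.isMaximal.mem_iff_models, models_sentence_iff,
    models_sentence_iff]
  refine forall_congr' fun N => ?_
  let s1 : L[[C]].Structure N := (L[[C]].lhomWithConstants α).reduct N
  let s0 : L.Structure N := (L.lhomWithConstants C).reduct N
  have : (L.lhomWithConstants C).IsExpansionOn N := LHom.isExpansionOn_reduct _ _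
  have : (L[[C]].lhomWithConstants α).IsExpansionOn N := LHom.isExpansionOn_reduct _ _
  rw [realize_code, realize_code, Formula.realize_relabel, Formula.realize_relabel,
    Formula.realize_relabel, Function.comp_assoc]

theorem ext_holds {C : Type w} {α : Type x} {T : L[[C]].Theory} {p q : T.CompleteType α}
    (h : ∀ φ : L.Formula (C ⊕ α), Holds p φ ↔ Holds q φ) : p = q := by
  refine SetLike.ext fun s => ?_
  have := h (BoundedFormula.constantsVarsEquiv (Formula.equivSentence.symm s))
  unfold Holds at this
  simpa using this

theorem restrictVars_tp [Nonempty M] (A : Set M) {α : Type x} {β : Type y} (f : α → β)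
    (b : β → M) : restrictVars f (tp L A b) = tp L A (b ∘ f) := by
  refine ext_holds fun φ => ?_
  rw [holds_restrictVars, holds_tp, holds_tp, Formula.realize_relabel]
  refine iff_of_eq (congrArg _ ?_)
  funext z
  rcases z with z | z <;> rfl

theorem restrictParams_restrictVars (A : Set M) {α : Type x} {β : Type y} (f : α → β)
    (p : GlobalType L M β) :
    restrictParams A (restrictVars f p) = restrictVars f (restrictParams A p) := by
  refine ext_holds fun φ => ?_
  rw [holds_restrictVars, holds_restrictParams, holds_restrictVars, holds_restrictParams,
    holds_relabel_relabel, holds_relabel_relabel, Sum.map_comp_map, Sum.map_comp_map]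
  rfl

theorem restrictParams_tp_mono [Nonempty M] {A B : Set M} (h : A ⊆ B) {α : Type x}
    {p : GlobalType L M α} {a : α → M} (hp : restrictParams B p = tp L B a) :
    restrictParams A p = tp L A a := by
  refine ext_holds fun φ => ?_
  have h1 : Holds (restrictParams B p) (φ.relabel (Sum.map (Set.inclusion h) id)) ↔
      Holds (tp L B a) (φ.relabel (Sum.map (Set.inclusion h) id)) := by rw [hp]
  rw [holds_restrictParams, holds_relabel_relabel, Sum.map_comp_map, holds_tp,
    Formula.realize_relabel] at h1
  rw [holds_restrictParams, holds_tp]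
  refine h1.trans (iff_of_eq (congrArg _ ?_))
  funext z
  rcases z with z | z <;> rfl

end Types

/-! ### The monster model, invariance, coheirs -/

section Invariance

variable (L : FirstOrder.Language.{u, v}) (M : Type w) [L.Structure M] [Nonempty M]

/-- `M` is a monster model at the cardinal `κ`: `κ` is uncountable and exceeds the size of the
language, `M` is `κ`-saturated, and `M` is strongly `κ`-homogeneous (every partial elementary map
with domain of size less than `κ` extends to an automorphism). Subsets of `M` of size less than `κ`
are the small ones. -/
structure IsMonster (κ : Cardinal.{w}) : Prop where
  uncountable : ℵ₀ < κ
  card_language_lt : Cardinal.lift.{w} L.card < Cardinal.lift.{max u v} κ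
  saturated : ∀ B : Set M, #B < κ → ∀ q : TypeOver L B (Fin 1), ∃ b : Fin 1 → M, tp L B b = q
  homogeneous : ∀ (B : Set M) (f : B → M), #B < κ →
    (∀ φ : L.Formula B, φ.Realize (fun b => (b : M)) ↔ φ.Realize f) →
    ∃ σ : M ≃[L] M, ∀ b : B, σ b = f b

variable {L M}

/-- A global type is `A`-invariant if it is fixed by all automorphisms fixing `A` pointwise. -/
def IsInvariantOver (A : Set M) {α : Type x} (p : GlobalType L M α) : Prop :=
  ∀ σ : M ≃[L] M, (∀ a ∈ A, σ a = a) →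
    ∀ φ : L.Formula (M ⊕ α), Holds p φ ↔ Holds p (φ.relabel (Sum.map σ id))

/-- A global type is an `A`-coheir if each of its formulas is satisfied by a tuple from `A`. -/
def IsCoheir (A : Set M) {α : Type x} (p : GlobalType L M α) : Prop :=
  ∀ φ : L.Formula (M ⊕ α), Holds p φ → ∃ a : α → M, (∀ i, a i ∈ A) ∧ φ.Realize (Sum.elim id a)

variable (L) in
/-- `A` is an invariance base if every type over `A` extends to a global `A`-invariant type. -/
def IsInvarianceBase (A : Set M) : Prop :=
  ∀ (α : Type w) (q : TypeOver L A α), ∃ p : GlobalType L M α,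
    IsInvariantOver A p ∧ restrictParams A p = q

variable (L) in
/-- `b` is invariantly independent from the set `C` over `A`: the type `tp(b/AC)` extends to a
global `A`-invariant type. -/
def InvIndep (A : Set M) {α : Type x} (b : α → M) (C : Set M) : Prop :=
  ∃ p : GlobalType L M α, IsInvariantOver A p ∧ restrictParams (A ∪ C) p = tp L (A ∪ C) b

variable (L) in
/-- `(b_i)_{i < n}` is an invariant sequence over `A`: all `b_i` have the same type over `A`, and
each `b_i` is invariantly independent from `b_{<i}` over `A`. -/
def IsInvariantSequence (A : Set M) {n : ℕ} {α : Type x} (b : Fin n → α → M) : Prop :=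
  (∀ i j, tp L A (b i) = tp L A (b j)) ∧
    ∀ i, InvIndep L A (b i) (⋃ j : {j : Fin n // j < i}, Set.range (b j))

/-- `q(x_0, …, x_{n-1})` is the type over `A` of an invariant sequence. So that this makes sense
also for tuples of variables `x_i` that are too long to be realized in `M`, it is expressed by
finite subtuples: for every finite set `s` of indices, the type of the corresponding subtuples is
realized by an invariant sequence in `M`. If `q` is realized in `M` by an invariant sequence then
this holds (`isInvariantSequenceType_tp`). -/
def IsInvariantSequenceType (A : Set M) {n : ℕ} {α : Type x} (q : TypeOver L A (Fin n × α)) :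
    Prop :=
  ∀ s : Finset α, ∃ b : Fin n → s → M, IsInvariantSequence L A b ∧
    tp L A (fun z : Fin n × s => b z.1 z.2) =
      restrictVars (fun z : Fin n × s => (z.1, (z.2 : α))) q

theorem IsInvariantOver.restrictVars {A : Set M} {α : Type x} {β : Type y} (f : α → β)
    {p : GlobalType L M β} (hp : IsInvariantOver A p) :
    IsInvariantOver A (ReliableTypes.restrictVars f p) := by
  intro σ hσ φ
  rw [holds_restrictVars, holds_restrictVars, hp σ hσ, holds_relabel_relabel,
    holds_relabel_relabel, Sum.map_comp_map, Sum.map_comp_map]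
  rfl

theorem isInvariantSequenceType_tp {A : Set M} {n : ℕ} {α : Type x} {b : Fin n → α → M}
    (hb : IsInvariantSequence L A b) :
    IsInvariantSequenceType A (tp L A (fun z : Fin n × α => b z.1 z.2)) := by
  intro s
  refine ⟨fun i z => b i z, ⟨fun i j => ?_, fun i => ?_⟩, ?_⟩
  · have h := congrArg (restrictVars (fun z : s => (z : α))) (hb.1 i j)
    rw [restrictVars_tp, restrictVars_tp] at h
    exact h
  · obtain ⟨p, hp, h⟩ := hb.2 i
    refine ⟨restrictVars (fun z : s => (z : α)) p, hp.restrictVars _, ?_⟩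
    have h' := congrArg (restrictVars (fun z : s => (z : α))) h
    rw [← restrictParams_restrictVars, restrictVars_tp] at h'
    refine restrictParams_tp_mono (Set.union_subset_union_right _ ?_) h'
    refine Set.iUnion_mono fun j => ?_
    rintro _ ⟨z, rfl⟩
    exact ⟨z, rfl⟩
  · rw [restrictVars_tp]
    rfl

end Invariance

/-! ### Reliability -/

section Reliable

variable (L : FirstOrder.Language.{u, v}) (M : Type w) [L.Structure M] [Nonempty M]

/-- Classes of global types, in arbitrary tuples of variables. -/
abbrev TypeClass := ∀ α : Type w, Set (GlobalType L M α)

variable {L M}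

/-- The class `R` is contained in `I` and has the three closure properties that define
reliability. The inclusion of a tuple of variables `x` in a tuple `xy` is given by an
embedding `f` of index types. -/
structure IsReliableClass (A : Set M) (I R : TypeClass L M) : Prop where
  subset : ∀ α, R α ⊆ I α
  restrict : ∀ (α β : Type w) (f : α ↪ β), ∀ p ∈ R β, restrictVars f p ∈ R α
  extend : ∀ (α β : Type w) (f : α ↪ β), ∀ p ∈ R α, ∀ q : TypeOver L A β,
    restrictVars f q = restrictParams A p →
    ∃ r ∈ R β, restrictVars f r = p ∧ restrictParams A r = q
  sequence : ∀ (α : Type w) (n : ℕ), ∀ p ∈ R α, ∀ q : TypeOver L A (Fin (n + 1) × α),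
    restrictVars (fun z => ((0 : Fin (n + 1)), z)) q = restrictParams A p →
    IsInvariantSequenceType A q →
    ∃ r ∈ R (Fin (n + 1) × α), (∀ i : Fin (n + 1), restrictVars (fun z => (i, z)) r = p) ∧
      restrictParams A r = q

/-- The class of all global types that are reliably in `I` (relative to `A`): the union of all
classes with the defining closure properties. It is the largest such class, see
`isGreatest_reliably`. -/
def Reliably (A : Set M) (I : TypeClass L M) : TypeClass L M :=
  fun α => {p | ∃ R : TypeClass L M, IsReliableClass A I R ∧ p ∈ R α}

theorem isGreatest_reliably (A : Set M) (I : TypeClass L M) :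
    IsGreatest {R : TypeClass L M | IsReliableClass A I R} (Reliably A I) := by
  refine ⟨⟨?_, ?_, ?_, ?_⟩, fun R hR α p hp => ⟨R, hR, hp⟩⟩
  · rintro α p ⟨R, hR, hp⟩
    exact hR.subset α hp
  · rintro α β f p ⟨R, hR, hp⟩
    exact ⟨R, hR, hR.restrict α β f p hp⟩
  · rintro α β f p ⟨R, hR, hp⟩ q hq
    obtain ⟨r, hr, h⟩ := hR.extend α β f p hp q hq
    exact ⟨r, ⟨R, hR, hr⟩, h⟩
  · rintro α n p ⟨R, hR, hp⟩ q hq hs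
    obtain ⟨r, hr, h⟩ := hR.sequence α n p hp q hq hs
    exact ⟨r, ⟨R, hR, hr⟩, h⟩

/-- Reliably `A`-invariant types: those reliably in the class of all `A`-invariant types. -/
def IsReliablyInvariant (A : Set M) {α : Type w} (p : GlobalType L M α) : Prop :=
  p ∈ Reliably A (fun _ => {p | IsInvariantOver A p}) α

/-- Reliable `A`-coheirs: the types reliably in the class of all `A`-coheirs. -/
def IsReliableCoheir (A : Set M) {α : Type w} (p : GlobalType L M α) : Prop :=
  p ∈ Reliably A (fun _ => {p | IsCoheir A p}) α

end Reliable

/-! ### Kim-dividing, Kim-forking, Kim-strict invariance -/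

section Kim

variable {L : FirstOrder.Language.{u, v}} {M : Type w} [L.Structure M] [Nonempty M]

/-- `(e_i)_{i < ω}` is a Morley sequence over `A` generated by the global type `q`:
`e_i` realizes `q ↾ A e_{<i}` for each `i`. -/
def IsMorleySequence (A : Set M) {β : Type x} (q : GlobalType L M β) (e : ℕ → β → M) : Prop :=
  ∀ i, restrictParams (A ∪ ⋃ j : {j : ℕ // j < i}, Set.range (e j)) q =
    tp L (A ∪ ⋃ j : {j : ℕ // j < i}, Set.range (e j)) (e i)

/-- The formula `φ(x, c)` Kim-divides over `A`: there are an `A`-invariant type `q` extending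
`tp(c/A)` and a Morley sequence `(e_i)` over `A` generated by `q` such that
`{φ(x, e_i) : i < ω}` is inconsistent. (Parameters from `A` may be among the `c`.) -/
def KimDivides (A : Set M) {γ : Type x} {m : ℕ} (φ : L.Formula (γ ⊕ Fin m)) (c : Fin m → M) :
    Prop :=
  ∃ q : GlobalType L M (Fin m), IsInvariantOver A q ∧ restrictParams A q = tp L A c ∧
    ∃ e : ℕ → Fin m → M, IsMorleySequence A q e ∧
      ∃ s : Finset ℕ, ¬ ∃ a : γ → M, ∀ i ∈ s, φ.Realize (Sum.elim a (e i))

/-- The formula `φ(x, c)` Kim-forks over `A`: it implies a finite disjunction of formulas each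
of which Kim-divides over `A`. -/
def KimForks (A : Set M) {γ : Type x} {m : ℕ} (φ : L.Formula (γ ⊕ Fin m)) (c : Fin m → M) :
    Prop :=
  ∃ (n : ℕ) (k : Fin n → ℕ) (ψ : ∀ j, L.Formula (γ ⊕ Fin (k j))) (d : ∀ j, Fin (k j) → M),
    (∀ j, KimDivides A (ψ j) (d j)) ∧
      ∀ a : γ → M, φ.Realize (Sum.elim a c) → ∃ j, (ψ j).Realize (Sum.elim a (d j))

variable (L) in
/-- `b` is Kim-independent from the set `C` over `A`: no formula in `tp(b/AC)` Kim-forks over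
`A`. -/
def KimIndep (A : Set M) {γ : Type x} (b : γ → M) (C : Set M) : Prop :=
  ∀ (m : ℕ) (φ : L.Formula (γ ⊕ Fin m)) (c : Fin m → M), (∀ i, c i ∈ A ∪ C) →
    φ.Realize (Sum.elim b c) → ¬ KimForks A φ c

/-- An `A`-invariant type `p` is Kim-strictly `A`-invariant if whenever `a` realizes `p ↾ Ab`, the
tuple `b` is Kim-independent from `a` over `A`. -/
def IsKimStrictlyInvariant (A : Set M) {α : Type w} (p : GlobalType L M α) : Prop :=
  IsInvariantOver A p ∧ ∀ (β : Type w) (b : β → M) (a : α → M),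
    restrictParams (A ∪ Set.range b) p = tp L (A ∪ Set.range b) a →
    KimIndep L A b (Set.range a)

end Kim

end ReliableTypes

open ReliableTypes

/-! Reliability is reached by maximality. A constraint is a pair of a type `q` over `A` in finitely
many variables and a formula `φ` over `M`; a type avoids it if `φ` holds at no subtuple of its
variables that has type `q`. By Zorn's lemma and compactness there is a maximal set `F` of
constraints such that every type over `A` still extends to a type in `I` avoiding all of `F`. The
class `R` of types in `I` avoiding `F` is reliable. Indeed, if `φ` holds at a subtuple of type `q`
in some `p` of `R`, then `(q, φ)` is not in `F` and cannot be added to it: there is a type `Q` over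
`A` all of whose extensions in `R` have `φ` at some subtuple of type `q` (`IsUnavoidable`).

That subtuple is not known in advance, so every candidate is prepared. To extend `p` along a type
over `A`, a copy of this type is attached to all subtuples of `Q` of the right type
(`exists_attach`); the result extends to a member of `R`, which is then restricted to the copy
sitting where `φ` turned up. This secures one formula of `p`, and compactness secures all of them.
For invariant sequences, `IsUnavoidable.exists_sequence` forces `φ` at all terms of a sequence of
prescribed type. Invariance enters through `exists_add_of_invIndep`: a single new term has the right
relation to all candidates for the preceding terms.

Kim-strictness (`IsReliableClass.kimIndep`) uses only the closure properties. If a formula of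
`tp(b/Aa)` implies a disjunction of Kim-dividing formulas `ψ j` with parameters `d j`, extend the
type of `a` inside `R` by variables for the `d j`; then some `ψ j` with `b` plugged in lies in the
extension. The sequence property spreads it along a finite piece of a Morley sequence, contradicting
Kim-dividing. -/

namespace ReliableTypes

open FirstOrder.Language FirstOrder.Language.Theory

/-! ### Complete types as sets of formulas in finitely many variables -/

section Formulas

variable {L : FirstOrder.Language.{u, v}}

/-- A complete type is the set of formulas satisfied by some tuple in some structure in which the
sentences of the theory hold. -/
theorem exists_structure_holds_iff {C : Type y} {α : Type x} {T : L[[C]].Theory}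
    (p : T.CompleteType α) :
    ∃ (N : Type (max u v x y)) (_ : L.Structure N) (_ : Nonempty N) (a : C ⊕ α → N),
      (∀ φ : L.Formula (C ⊕ α), Holds p φ ↔ φ.Realize a) ∧
        ∀ ψ : L.Formula C, Formula.equivSentence ψ ∈ T → ψ.Realize (a ∘ Sum.inl) := by
  obtain ⟨N⟩ := p.isMaximal.1
  let s1 : L[[C]].Structure N := (L[[C]].lhomWithConstants α).reduct N
  let s0 : L.Structure N := (L.lhomWithConstants C).reduct N
  have : (L.lhomWithConstants C).IsExpansionOn N := LHom.isExpansionOn_reduct _ _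
  have : (L[[C]].lhomWithConstants α).IsExpansionOn N := LHom.isExpansionOn_reduct _ _
  refine ⟨N, s0, inferInstance,
    Sum.elim (fun c => (L.con c : N)) (fun a => (L[[C]].con a : N)), fun φ => ?_, fun ψ hψ => ?_⟩
  · rw [← realize_code (C := C) (α := α), p.isMaximal.isComplete.realize_sentence_iff _ N,
      ← p.isMaximal.mem_iff_models]
    rfl
  · have h : (L[[C]].lhomWithConstants α).onSentence (Formula.equivSentence ψ) ∈ p :=
      p.subset ⟨_, hψ, rfl⟩
    have h' : N ⊨ (L[[C]].lhomWithConstants α).onSentence (Formula.equivSentence ψ) :=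
      N.is_model.realize_of_mem _ h
    rw [LHom.realize_onSentence] at h'
    exact (Formula.realize_equivSentence N ψ).1 h'

theorem holds_congr {C : Type y} {α : Type x} {T : L[[C]].Theory} {p : T.CompleteType α}
    {φ ψ : L.Formula (C ⊕ α)}
    (h : ∀ (N : Type (max u v x y)) [L.Structure N] (a : C ⊕ α → N), φ.Realize a ↔ ψ.Realize a) :
    Holds p φ ↔ Holds p ψ := by
  obtain ⟨N, _, _, a, ha, -⟩ := exists_structure_holds_iff p
  rw [ha, ha]
  exact h N a

theorem holds_inf {C : Type y} {α : Type x} {T : L[[C]].Theory} {p : T.CompleteType α}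
    {φ ψ : L.Formula (C ⊕ α)} : Holds p (φ ⊓ ψ) ↔ Holds p φ ∧ Holds p ψ := by
  obtain ⟨N, _, _, a, ha, -⟩ := exists_structure_holds_iff p
  rw [ha, ha, ha]
  exact Formula.realize_inf

theorem holds_not {C : Type y} {α : Type x} {T : L[[C]].Theory} {p : T.CompleteType α}
    {φ : L.Formula (C ⊕ α)} : Holds p φ.not ↔ ¬ Holds p φ := by
  obtain ⟨N, _, _, a, ha, -⟩ := exists_structure_holds_iff p
  rw [ha, ha]
  exact Formula.realize_not

theorem exists_holds {C : Type y} {α : Type x} {T : L[[C]].Theory} (p : T.CompleteType α) :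
    ∃ φ : L.Formula (C ⊕ α), Holds p φ := by
  by_cases h : Holds p ⊥
  · exact ⟨_, h⟩
  · exact ⟨_, holds_not.2 h⟩

theorem eq_of_forall_holds_imp {C : Type w} {α : Type x} {T : L[[C]].Theory}
    {p q : T.CompleteType α} (h : ∀ φ : L.Formula (C ⊕ α), Holds p φ → Holds q φ) : p = q := by
  refine ext_holds fun φ => ⟨h φ, fun hq => ?_⟩
  by_contra hp
  exact holds_not.1 (h _ (holds_not.2 hp)) hq

/-- The finite set of free variables of a formula. -/
noncomputable def support {V : Type*} (φ : L.Formula V) : Finset V := by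
  classical exact BoundedFormula.freeVarFinset φ

/-- A formula all of whose free variables are in the range of `g`, as a formula in the
preimages of these variables. -/
noncomputable def pullback {V V' : Type*} (φ : L.Formula V) (g : V' → V)
    (h : ∀ z ∈ support φ, z ∈ range g) : L.Formula V' := by
  classical exact BoundedFormula.restrictFreeVar φ fun z => (h z z.2).choose

theorem realize_pullback {V V' N : Type*} [L.Structure N] {φ : L.Formula V} {g : V' → V}
    (h : ∀ z ∈ support φ, z ∈ range g) (a : V → N) :
    (pullback φ g h).Realize (a ∘ g) ↔ φ.Realize a := by
  classical
  exact BoundedFormula.realize_restrictFreeVar a fun z => congrArg a (h z z.2).choose_spec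

theorem holds_restrictVars_pullback {C : Type w} {α : Type x} {β : Type y} {T : L[[C]].Theory}
    {f : α → β} {p : T.CompleteType β} {φ : L.Formula (C ⊕ β)}
    (h : ∀ z ∈ support φ, z ∈ range (Sum.map (id : C → C) f)) :
    Holds (restrictVars f p) (pullback φ _ h) ↔ Holds p φ := by
  rw [holds_restrictVars]
  refine holds_congr fun N _ a => ?_
  rw [Formula.realize_relabel, realize_pullback]

/-- Any formula involves only finitely many of the variables of a type. -/
theorem exists_fin_formula {C : Type w} {α : Type x} (φ : L.Formula (C ⊕ α)) :
    ∃ (m : ℕ) (e : Fin m ↪ α) (ψ : L.Formula (C ⊕ Fin m)), ∀ {T : L[[C]].Theory}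
      (p : T.CompleteType α), Holds (restrictVars e p) ψ ↔ Holds p φ := by
  classical
  let s : Finset α := (support φ).preimage Sum.inr Sum.inr_injective.injOn
  let e : Fin s.card ↪ α := s.equivFin.symm.toEmbedding.trans (Function.Embedding.subtype _)
  have h : ∀ z ∈ support φ, z ∈ range (Sum.map (id : C → C) e) := by
    rintro (c | z) hz
    · exact ⟨Sum.inl c, rfl⟩
    · have hz' : z ∈ s := Finset.mem_preimage.2 hz
      exact ⟨Sum.inr (s.equivFin ⟨z, hz'⟩), by simp [e]⟩
  exact ⟨_, e, pullback φ _ h, fun p => holds_restrictVars_pullback h⟩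

theorem restrictVars_restrictVars {C : Type w} {α β γ : Type*} {T : L[[C]].Theory} (f : α → β)
    (g : β → γ) (p : T.CompleteType γ) :
    restrictVars f (restrictVars g p) = restrictVars (g ∘ f) p := by
  refine ext_holds fun φ => ?_
  rw [holds_restrictVars, holds_restrictVars, holds_restrictVars, holds_relabel_relabel,
    Sum.map_comp_map]
  rfl

theorem restrictVars_id {C : Type w} {α : Type x} {T : L[[C]].Theory} (p : T.CompleteType α) :
    restrictVars id p = p := by
  refine ext_holds fun φ => ?_
  rw [holds_restrictVars]
  refine holds_congr fun N _ a => ?_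
  rw [Formula.realize_relabel, Sum.map_id_id, Function.comp_id]

/-- A complete type is determined by its restrictions to finite sets of variables. -/
theorem eq_of_forall_finset {C : Type w} {α : Type x} {T : L[[C]].Theory} {p q : T.CompleteType α}
    (h : ∀ s : Finset α, restrictVars (fun z : s => (z : α)) p =
      restrictVars (fun z : s => (z : α)) q) : p = q := by
  classical
  refine ext_holds fun φ => ?_
  obtain ⟨m, e, ψ, hψ⟩ := exists_fin_formula φ
  rw [← hψ, ← hψ]
  have h1 := congrArg (restrictVars (fun i : Fin m =>
    (⟨e i, by simp⟩ : (Finset.univ.map e : Finset α)))) (h (Finset.univ.map e))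
  rw [restrictVars_restrictVars, restrictVars_restrictVars] at h1
  exact iff_of_eq (congrArg (Holds · ψ) h1)

end Formulas

/-! ### Continuity of restriction and compactness of type spaces -/

section Topology

variable {L : FirstOrder.Language.{u, v}}

theorem isClopen_setOf_holds {C : Type y} {α : Type x} {T : L[[C]].Theory}
    (φ : L.Formula (C ⊕ α)) : IsClopen {p : T.CompleteType α | Holds p φ} :=
  CompleteType.isClopen_typesWith _

theorem continuous_restrictVars {C : Type w} {α : Type x} {β : Type y} {T : L[[C]].Theory}
    (f : α → β) : Continuous (restrictVars f : T.CompleteType β → T.CompleteType α) := by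
  refine continuous_generateFrom_iff.2 ?_
  rintro _ ⟨φ, rfl⟩
  exact CompleteType.isOpen_typesWith ((L[[C]].lhomWithConstantsMap f).onSentence φ)

theorem continuous_restrictParams {M : Type w} [L.Structure M] (A : Set M) {α : Type x} :
    Continuous (restrictParams A : GlobalType L M α → TypeOver L A α) := by
  refine continuous_generateFrom_iff.2 ?_
  rintro _ ⟨φ, rfl⟩
  exact CompleteType.isOpen_typesWith
    (((L.lhomWithConstantsMap ((↑) : A → M)).addConstants α).onSentence φ)

/-- Applied with `ι` consisting of finite sets of variables: a type in a tuple too long to be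
realized is obtained from realizations in `M` of its finite requirements. -/
theorem exists_mem_forall_of_antitone {ι X : Type*} [Preorder ι] [IsDirectedOrder ι] [Nonempty ι]
    [TopologicalSpace X] [CompactSpace X] (K : ι → Set X) (hK : Antitone K)
    (hc : ∀ i, IsClosed (K i)) (hn : ∀ i, (K i).Nonempty) : ∃ x, ∀ i, x ∈ K i := by
  obtain ⟨x, hx⟩ := IsCompact.nonempty_iInter_of_directed_nonempty_isCompact_isClosed K
    hK.directed_ge hn (fun i => (hc i).isCompact) hc
  exact ⟨x, mem_iInter.1 hx⟩

/-- A form of compactness: closed sets indexed by the formulas of a complete type have a common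
element if they are nonempty and decrease under conjunctions. -/
theorem exists_forall_holds_mem {C : Type y} {α : Type x} {T : L[[C]].Theory}
    (q : T.CompleteType α) {X : Type*} [TopologicalSpace X] [CompactSpace X]
    (K : L.Formula (C ⊕ α) → Set X) (hc : ∀ φ, IsClosed (K φ))
    (hK : ∀ φ ψ, K (φ ⊓ ψ) ⊆ K φ ∩ K ψ) (hn : ∀ φ, Holds q φ → (K φ).Nonempty) :
    ∃ z, ∀ φ, Holds q φ → z ∈ K φ := by
  have : Nonempty {φ : L.Formula (C ⊕ α) // Holds q φ} := nonempty_subtype.2 (exists_holds q)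
  obtain ⟨z, hz⟩ := IsCompact.nonempty_iInter_of_directed_nonempty_isCompact_isClosed
    (fun φ : {φ : L.Formula (C ⊕ α) // Holds q φ} => K φ)
    (fun φ ψ => ⟨⟨_, holds_inf.2 ⟨φ.2, ψ.2⟩⟩, fun z hz => (hK _ _ hz).1, fun z hz => (hK _ _ hz).2⟩)
    (fun φ => hn φ φ.2) (fun φ => (hc φ).isCompact) (fun φ => hc φ)
  exact ⟨z, fun φ hφ => mem_iInter.1 hz ⟨φ, hφ⟩⟩

end Topology

/-! ### Saturation and homogeneity for finite tuples -/

section Monster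

variable {L : FirstOrder.Language.{u, v}} {M : Type w} [L.Structure M]

theorem holds_of_realize {A : Set M} {α : Type x} (q : TypeOver L A α) {φ : L.Formula A}
    (h : φ.Realize (fun c : A => (c : M))) : Holds q (φ.relabel Sum.inl) := by
  obtain ⟨N, _, _, a, ha, hT⟩ := exists_structure_holds_iff q
  rw [ha, Formula.realize_relabel]
  refine hT φ ?_
  rw [mem_completeTheory]
  exact (Formula.realize_equivSentence M φ).2 h

theorem holds_relabel_inl {A : Set M} {α : Type x} (q : TypeOver L A α) {φ : L.Formula A} :
    Holds q (φ.relabel Sum.inl) ↔ φ.Realize (fun c : A => (c : M)) := by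
  refine ⟨fun h => ?_, holds_of_realize q⟩
  by_contra h'
  have h1 := holds_of_realize q (φ := φ.not) h'
  obtain ⟨N, _, _, a, ha, -⟩ := exists_structure_holds_iff q
  rw [ha, Formula.realize_relabel] at h h1
  exact h1 h

variable {κ : Cardinal.{w}}

theorem mk_union_range_lt {A : Set M} (hκ : ℵ₀ < κ) (hA : #A < κ) {γ : Type x} [Finite γ]
    (c : γ → M) : #(A ∪ range c : Set M) < κ :=
  (mk_union_le _ _).trans_lt
    (add_lt_of_lt hκ.le hA ((lt_aleph0_iff_finite.2 (finite_range c)).trans hκ))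

variable [Nonempty M]

theorem tp_eq_iff {A : Set M} {α : Type x} {a b : α → M} :
    tp L A a = tp L A b ↔ ∀ φ : L.Formula (A ⊕ α),
      φ.Realize (Sum.elim (fun c : A => (c : M)) a) ↔
        φ.Realize (Sum.elim (fun c : A => (c : M)) b) := by
  refine ⟨fun h φ => ?_, fun h => ext_holds fun φ => ?_⟩
  · rw [← holds_tp, h, holds_tp]
  · rw [holds_tp, holds_tp, h]

/-- Homogeneity concerns maps on subsets, whereas `c` may repeat elements or meet `A`. Equality
formulas in the type make the assignment of `d` to `c` well defined. -/
theorem exists_equiv_of_tp_eq (hM : IsMonster L M κ) {A : Set M} (hA : #A < κ) {γ : Type x}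
    [Finite γ] {c d : γ → M} (h : tp L A c = tp L A d) :
    ∃ σ : M ≃[L] M, (∀ a ∈ A, σ a = a) ∧ ∀ i, σ (c i) = d i := by
  rw [tp_eq_iff] at h
  let c' : A ⊕ γ → M := Sum.elim (fun a : A => (a : M)) c
  let d' : A ⊕ γ → M := Sum.elim (fun a : A => (a : M)) d
  have hs : ∀ b : (A ∪ range c : Set M), ∃ z, c' z = b := by
    rintro ⟨b, hb | ⟨i, rfl⟩⟩
    · exact ⟨Sum.inl ⟨b, hb⟩, rfl⟩
    · exact ⟨Sum.inr i, rfl⟩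
  choose t ht using hs
  have heq : ∀ z z' : A ⊕ γ, c' z = c' z' → d' z = d' z' := by
    intro z z' hz
    have := (h (Term.equal (var z) (var z'))).1 (by
      simp only [Formula.realize_equal, Term.realize_var]; exact hz)
    simpa only [Formula.realize_equal, Term.realize_var] using this
  obtain ⟨σ, hσ⟩ := hM.homogeneous (A ∪ range c) (d' ∘ t)
    (mk_union_range_lt hM.uncountable hA c) (by
      intro φ
      have := h (φ.relabel t)
      rw [Formula.realize_relabel, Formula.realize_relabel] at this
      refine Iff.trans (iff_of_eq (congrArg _ ?_)) this
      funext b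
      exact (ht b).symm)
  refine ⟨σ, fun a ha => ?_, fun i => ?_⟩
  · exact (hσ ⟨a, Or.inl ha⟩).trans (heq _ (Sum.inl ⟨a, ha⟩) (ht _))
  · exact (hσ ⟨c i, Or.inr ⟨i, rfl⟩⟩).trans (heq _ (Sum.inr i) (ht _))

/-- Saturation is assumed for one variable only, so coordinates are added one at a time, with those
already found becoming parameters. -/
theorem exists_tp_eq_fin (hM : IsMonster L M κ) {A : Set M} (hA : #A < κ) {m : ℕ}
    (q : TypeOver L A (Fin m)) : ∃ c : Fin m → M, tp L A c = q := by
  induction m with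
  | zero =>
    refine ⟨Fin.elim0, ext_holds fun φ => ?_⟩
    have hz : ∀ z ∈ support φ, z ∈ range (Sum.inl : A → A ⊕ Fin 0) := by
      rintro (a | i) -
      · exact ⟨a, rfl⟩
      · exact i.elim0
    rw [holds_tp, ← realize_pullback hz, Sum.elim_comp_inl, ← holds_relabel_inl q]
    refine holds_congr fun N _ a => ?_
    rw [Formula.realize_relabel, realize_pullback]
  | succ m ih =>
    obtain ⟨c, hc⟩ := ih (restrictVars Fin.castSucc q)
    let B : Set M := A ∪ range c
    let g : A ⊕ Fin (m + 1) → B ⊕ Fin 1 := Sum.elim (fun a => Sum.inl ⟨a, Or.inl a.2⟩)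
      (Fin.lastCases (Sum.inr 0) fun i => Sum.inl ⟨c i, Or.inr ⟨i, rfl⟩⟩)
    have hg : ∀ b : M, Sum.elim (fun z : B => (z : M)) (fun _ => b) ∘ g =
        Sum.elim (fun z : A => (z : M)) (Fin.snoc (α := fun _ => M) c b) := by
      intro b
      funext z
      rcases z with a | i
      · rfl
      · refine Fin.lastCases ?_ (fun i => ?_) i <;> simp [g]
    -- With `c` substituted for the first `m` variables, `q` is finitely satisfiable, since `c`
    -- satisfies the existential closures of its formulas. Compactness completes it to a 1-type over
    -- `A ∪ range c`.
    obtain ⟨t, ht⟩ := exists_forall_holds_mem q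
      (fun φ => {t : TypeOver L B (Fin 1) | Holds t (φ.relabel g)})
      (fun φ => (isClopen_setOf_holds _).1) (fun φ ψ t ht => by
        have : Holds t (φ.relabel g ⊓ ψ.relabel g) := (holds_congr (by
          intro N _ a
          rw [Formula.realize_inf, Formula.realize_relabel, Formula.realize_relabel,
            Formula.realize_relabel, Formula.realize_inf])).1 ht
        exact holds_inf.1 this) (by
        intro φ hφ
        let j : A ⊕ Fin (m + 1) → (A ⊕ Fin m) ⊕ Unit :=
          Sum.elim (fun a => Sum.inl (Sum.inl a))
            (Fin.lastCases (Sum.inr ()) fun i => Sum.inl (Sum.inr i))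
        have h1 : Holds (restrictVars Fin.castSucc q) (Formula.iExs Unit (φ.relabel j)) := by
          rw [holds_restrictVars]
          obtain ⟨N, _, _, a, ha, -⟩ := exists_structure_holds_iff q
          rw [ha, Formula.realize_relabel, Formula.realize_iExs]
          refine ⟨fun _ => a (Sum.inr (Fin.last m)), ?_⟩
          rw [Formula.realize_relabel]
          refine (iff_of_eq (congrArg _ ?_)).1 ((ha φ).1 hφ)
          funext z
          rcases z with z | i
          · rfl
          · refine Fin.lastCases ?_ (fun i => ?_) i <;> simp [j]
        rw [← hc, holds_tp, Formula.realize_iExs] at h1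
        obtain ⟨b, hb⟩ := h1
        refine ⟨tp L B (fun _ => b ()), ?_⟩
        rw [mem_ofPred_eq, holds_tp, Formula.realize_relabel, hg]
        rw [Formula.realize_relabel] at hb
        refine (iff_of_eq (congrArg _ ?_)).1 hb
        funext z
        rcases z with z | i
        · rfl
        · refine Fin.lastCases ?_ (fun i => ?_) i <;> simp [j])
    obtain ⟨b, hb⟩ := hM.saturated B (mk_union_range_lt hM.uncountable hA c) t
    refine ⟨Fin.snoc (α := fun _ => M) c (b 0), (eq_of_forall_holds_imp fun φ hφ => ?_).symm⟩
    have h2 := ht φ hφ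
    rw [mem_ofPred_eq, ← hb, holds_tp, Formula.realize_relabel] at h2
    rw [holds_tp, ← hg, show (fun _ : Fin 1 => b 0) = b from
      funext fun i => congrArg b (Subsingleton.elim 0 i)]
    exact h2

/-- Types in finitely many variables over small sets are realized. -/
theorem exists_tp_eq (hM : IsMonster L M κ) {A : Set M} (hA : #A < κ) {γ : Type x} [Finite γ]
    (q : TypeOver L A γ) : ∃ c : γ → M, tp L A c = q := by
  obtain ⟨m, ⟨e⟩⟩ := Finite.exists_equiv_fin γ
  obtain ⟨c, hc⟩ := exists_tp_eq_fin hM hA (restrictVars e.symm q)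
  refine ⟨c ∘ e, ?_⟩
  rw [← restrictVars_tp, hc, restrictVars_restrictVars, Equiv.symm_comp_self, restrictVars_id]

theorem exists_tp_comp_eq (hM : IsMonster L M κ) {A : Set M} (hA : #A < κ) {β : Type x}
    (q : TypeOver L A β) (s : Finset β) : ∃ c : β → M,
      tp L A (fun z : s => c z) = restrictVars (fun z : s => (z : β)) q := by
  classical
  obtain ⟨c, hc⟩ := exists_tp_eq hM hA (restrictVars (fun z : s => (z : β)) q)
  refine ⟨fun z => if h : z ∈ s then c ⟨z, h⟩ else Classical.arbitrary M, ?_⟩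
  simp [hc]

/-- Finitely many formulas of a global type are realized in `M` together with its restriction to a
small set. -/
theorem exists_tp_eq_and_realize_iff (hM : IsMonster L M κ) {A : Set M} (hA : #A < κ) {γ : Type x}
    [Finite γ] (p : GlobalType L M γ) {ι : Type y} [Finite ι] (φ : ι → L.Formula (M ⊕ γ)) :
    ∃ c : γ → M, tp L A c = restrictParams A p ∧
      ∀ i, (φ i).Realize (Sum.elim id c) ↔ Holds p (φ i) := by
  classical
  -- The type is over all of `M`, but the given formulas mention only finitely many parameters, so
  -- it suffices to realize it over a small set.
  let P : Set M := ⋃ i, {b | Sum.inl b ∈ support (φ i)}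
  have hP : P.Finite := finite_iUnion fun i =>
    (support (φ i)).finite_toSet.preimage Sum.inl_injective.injOn
  have hB : #(A ∪ P : Set M) < κ := (mk_union_le _ _).trans_lt
    (add_lt_of_lt hM.uncountable.le hA ((lt_aleph0_iff_finite.2 hP).trans hM.uncountable))
  obtain ⟨c, hc⟩ := exists_tp_eq hM hB (restrictParams (A ∪ P) p)
  refine ⟨c, (restrictParams_tp_mono subset_union_left hc.symm).symm, fun i => ?_⟩
  have hz : ∀ z ∈ support (φ i),
      z ∈ range (Sum.map (fun b : (A ∪ P : Set M) => (b : M)) (id : γ → γ)) := by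
    rintro (b | z) hz
    · exact ⟨Sum.inl ⟨b, Or.inr (mem_iUnion.2 ⟨i, hz⟩)⟩, rfl⟩
    · exact ⟨Sum.inr z, rfl⟩
  have h1 : Holds (restrictParams (A ∪ P) p) (pullback (φ i) _ hz) ↔ Holds p (φ i) := by
    rw [holds_restrictParams]
    refine holds_congr fun N _ a => ?_
    rw [Formula.realize_relabel, realize_pullback]
  rw [← h1, ← hc, holds_tp, ← realize_pullback hz]
  refine iff_of_eq (congrArg _ ?_)
  funext z
  rcases z with z | z <;> rfl

end Monster

/-! ### Amalgamating types over `A` -/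

section Amalgamation

variable {L : FirstOrder.Language.{u, v}} {M : Type w} [L.Structure M] [Nonempty M]
  {κ : Cardinal.{w}}

theorem isClosed_setOf_restrictVars_eq {C : Type w} {α : Type x} {β : Type y} {T : L[[C]].Theory}
    (f : α → β) (q : T.CompleteType α) :
    IsClosed {p : T.CompleteType β | restrictVars f p = q} :=
  isClosed_singleton.preimage (continuous_restrictVars f)

theorem isClosed_ofPred_forall {X : Type*} [TopologicalSpace X] {ι : Sort*} {P : ι → X → Prop}
    (h : ∀ i, IsClosed {p | P i p}) : IsClosed {p | ∀ i, P i p} := by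
  rw [ofPred_forall]
  exact isClosed_iInter h

theorem tp_equiv_comp {A : Set M} (σ : M ≃[L] M) (hσ : ∀ a ∈ A, σ a = a) {α : Type x}
    (c : α → M) : tp L A (σ ∘ c) = tp L A c := by
  rw [tp_eq_iff]
  intro φ
  rw [← StrongHomClass.realize_formula σ φ (v := Sum.elim _ c)]
  refine iff_of_eq (congrArg _ ?_)
  funext z
  rcases z with z | z
  · exact (hσ z z.2).symm
  · rfl

/-- Given a type `Q` and a type `q` one may attach a copy of `q` along a finite subtuple `h` of its
variables to every tuple of variables of `Q` of the appropriate type, simultaneously. -/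
theorem exists_attach (hM : IsMonster L M κ) {A : Set M} (hA : #A < κ) {β δ : Type w} {γ : Type}
    [Finite γ] (Q : TypeOver L A β) (q : TypeOver L A δ) (h : γ ↪ δ) :
    ∃ (V : Type w) (i : β ↪ V) (Q' : TypeOver L A V), restrictVars i Q' = Q ∧
      ∀ g : γ ↪ β, restrictVars g Q = restrictVars h q →
        ∃ e : δ ↪ V, (∀ c, e (h c) = i (g c)) ∧ restrictVars e Q' = q := by
  classical
  let G : Type w := {g : γ ↪ β // restrictVars g Q = restrictVars h q}
  -- One copy of `δ` for each admissible `g`, glued to `β` by `e g`. The elements `(g, h c)` are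
  -- spare variables, subject to no condition.
  let V : Type w := β ⊕ (G × δ)
  let e (g : G) (d : δ) : V :=
    if hd : ∃ c, h c = d then Sum.inl (g.1 hd.choose) else Sum.inr (g, d)
  have eh : ∀ (g : G) (c : γ), e g (h c) = Sum.inl (g.1 c) := by
    intro g c
    have hd : ∃ c', h c' = h c := ⟨c, rfl⟩
    simp only [e, dif_pos hd, h.injective hd.choose_spec]
  have en : ∀ (g : G) (d : δ), (¬ ∃ c, h c = d) → e g d = Sum.inr (g, d) := by
    intro g d hd
    simp only [e, dif_neg hd]
  have einj : ∀ g, Function.Injective (e g) := by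
    intro g d d' hdd
    by_cases hd : ∃ c, h c = d <;> by_cases hd' : ∃ c, h c = d'
    · obtain ⟨c, rfl⟩ := hd
      obtain ⟨c', rfl⟩ := hd'
      rw [eh, eh] at hdd
      rw [g.1.injective (Sum.inl_injective hdd)]
    · obtain ⟨c, rfl⟩ := hd
      rw [eh, en g d' hd'] at hdd
      cases hdd
    · obtain ⟨c, rfl⟩ := hd'
      rw [eh, en g d hd] at hdd
      cases hdd
    · rw [en g d hd, en g d' hd'] at hdd
      cases hdd
      rfl
  -- Finite stage: the type on `s.1` is prescribed, and for each `g` with values in `s.1` also the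
  -- part of its copy on `s.2`.
  obtain ⟨Q', hQ'⟩ := exists_mem_forall_of_antitone
    (fun s : Finset β × Finset δ => {Q' : TypeOver L A V |
      (restrictVars (fun z : s.1 => (Sum.inl (z : β) : V)) Q' =
        restrictVars (fun z : s.1 => (z : β)) Q) ∧
      ∀ g : G, (∀ c, g.1 c ∈ s.1) → restrictVars (fun z : s.2 => e g z) Q' =
        restrictVars (fun z : s.2 => (z : δ)) q}) (by
      rintro s t hst Q' ⟨h1, h2⟩
      refine ⟨?_, fun g hg => ?_⟩
      · have := congrArg (restrictVars (fun z : s.1 => (⟨z, hst.1 z.2⟩ : t.1))) h1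
        rwa [restrictVars_restrictVars, restrictVars_restrictVars] at this
      · have := congrArg (restrictVars (fun z : s.2 => (⟨z, hst.2 z.2⟩ : t.2)))
          (h2 g fun c => hst.1 (hg c))
        rwa [restrictVars_restrictVars, restrictVars_restrictVars] at this) (by
      intro s
      refine (isClosed_setOf_restrictVars_eq _ _).inter ?_
      exact isClosed_ofPred_forall fun g => isClosed_ofPred_forall fun _ =>
        isClosed_setOf_restrictVars_eq _ _) (by
      rintro ⟨s, t⟩
      obtain ⟨c, hc⟩ := exists_tp_comp_eq hM hA Q s
      have hd : ∀ g : G, ∃ d : δ → M, (∀ c', g.1 c' ∈ s) → d ∘ h = c ∘ g.1 ∧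
          tp L A (fun z : t => d z) = restrictVars (fun z : t => (z : δ)) q := by
        intro g
        by_cases hg : ∀ c', g.1 c' ∈ s
        · have := Fintype.ofFinite γ
          obtain ⟨d, hd⟩ := exists_tp_comp_eq hM hA q (t ∪ Finset.univ.map h)
          have h1 : tp L A (d ∘ h) = tp L A (c ∘ g.1) := by
            have h2 := congrArg (restrictVars (fun z : γ =>
              (⟨h z, by simp⟩ : (t ∪ Finset.univ.map h : Finset δ)))) hd
            have h3 := congrArg (restrictVars (fun z : γ => (⟨g.1 z, hg z⟩ : s))) hc
            rw [restrictVars_tp, restrictVars_restrictVars] at h2 h3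
            exact h2.trans (g.2.symm.trans h3.symm)
          -- A realization of `q` is moved over `A` so that its `h`-part becomes the given tuple `c
          -- ∘ g`.
          obtain ⟨σ, hσA, hσ⟩ := exists_equiv_of_tp_eq hM hA h1
          refine ⟨σ ∘ d, fun _ => ⟨funext hσ, ?_⟩⟩
          have h2 := congrArg (restrictVars (fun z : t =>
              (⟨z, by simp [z.2]⟩ : (t ∪ Finset.univ.map h : Finset δ)))) hd
          rw [restrictVars_tp, restrictVars_restrictVars] at h2
          exact (tp_equiv_comp σ hσA (fun z : t => d z)).trans h2
        · exact ⟨fun _ => Classical.arbitrary M, fun h => absurd h hg⟩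
      choose d hd using hd
      let b : V → M := Sum.elim c fun z => d z.1 z.2
      refine ⟨tp L A b, ?_, fun g hg => ?_⟩
      · rw [restrictVars_tp, ← hc]
        rfl
      · rw [restrictVars_tp, ← (hd g hg).2]
        refine congrArg _ (funext fun z => ?_)
        change b (e g z) = d g z
        by_cases hz : ∃ c', h c' = z
        · obtain ⟨c', hc'⟩ := hz
          rw [← hc', eh]
          exact (congrFun (hd g hg).1 c').symm
        · exact congrArg b (en g z hz))
  refine ⟨V, ⟨Sum.inl, Sum.inl_injective⟩, Q', eq_of_forall_finset fun s => ?_, fun g hg => ?_⟩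
  · rw [restrictVars_restrictVars]
    exact (hQ' (s, ∅)).1
  · refine ⟨⟨e ⟨g, hg⟩, einj _⟩, eh _, eq_of_forall_finset fun t => ?_⟩
    have := Fintype.ofFinite γ
    rw [restrictVars_restrictVars]
    exact (hQ' (Finset.univ.map g, t)).2 ⟨g, hg⟩ fun c => by simp

/-- If `b` is invariantly independent from `c` over `A`, then to any type over `A` one may add a
copy of `b` which has the same relation to all tuples of variables that have the type of `c`. -/
theorem exists_add_of_invIndep (hM : IsMonster L M κ) {A : Set M} (hA : #A < κ)
    {γ δ : Type} [Finite γ] [Finite δ] {c : γ → M} {b : δ → M} (hb : InvIndep L A b (range c))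
    {β : Type w} (Q : TypeOver L A β) :
    ∃ Q' : TypeOver L A (β ⊕ δ), restrictVars Sum.inl Q' = Q ∧
      ∀ g : γ → β, restrictVars g Q = tp L A c →
        restrictVars (Sum.map g id) Q' = tp L A (Sum.elim c b) := by
  classical
  obtain ⟨p, hp, hpb⟩ := hb
  obtain ⟨Q', hQ'⟩ := exists_mem_forall_of_antitone
    (fun s : Finset β => {Q' : TypeOver L A (β ⊕ δ) |
      (restrictVars (fun z : s => (Sum.inl (z : β) : β ⊕ δ)) Q' =
        restrictVars (fun z : s => (z : β)) Q) ∧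
      ∀ g : γ → β, (∀ c, g c ∈ s) → restrictVars g Q = tp L A c →
        restrictVars (Sum.map g id) Q' = tp L A (Sum.elim c b)}) (by
      rintro s t hst Q' ⟨h1, h2⟩
      refine ⟨?_, fun g hg => h2 g fun c => hst (hg c)⟩
      have := congrArg (restrictVars (fun z : s => (⟨z, hst z.2⟩ : t))) h1
      rwa [restrictVars_restrictVars, restrictVars_restrictVars] at this) (by
      intro s
      refine (isClosed_setOf_restrictVars_eq _ _).inter ?_
      exact isClosed_ofPred_forall fun g => isClosed_ofPred_forall fun _ =>
        isClosed_ofPred_forall fun _ => isClosed_setOf_restrictVars_eq _ _) (by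
      intro s
      obtain ⟨a, ha⟩ := exists_tp_comp_eq hM hA Q s
      let a' : s → M := fun z => a z
      -- The new tuple realizes the invariant type `p` over all of `a'`. Any tuple from `a'` with
      -- the type of `c` is the image of `c` under an automorphism over `A`, and this automorphism
      -- fixes `p`; hence `d` relates to it as `b` does to `c`.
      obtain ⟨d, hd⟩ := exists_tp_eq hM (mk_union_range_lt hM.uncountable hA a')
        (restrictParams (A ∪ range a') p)
      refine ⟨tp L A (Sum.elim a d), ?_, fun g hg hgQ => ?_⟩
      · rw [restrictVars_tp, ← ha]
        rfl
      · rw [restrictVars_tp]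
        have h1 : tp L A c = tp L A (a ∘ g) := by
          have h3 := congrArg (restrictVars (fun z : γ => (⟨g z, hg z⟩ : s))) ha
          rw [restrictVars_tp, restrictVars_restrictVars] at h3
          exact hgQ.symm.trans h3.symm
        obtain ⟨σ, hσA, hσ⟩ := exists_equiv_of_tp_eq hM hA h1
        refine Eq.symm (ext_holds fun φ => ?_)
        rw [holds_tp, holds_tp]
        let k : A ⊕ (γ ⊕ δ) → M ⊕ δ :=
          Sum.elim (fun z => Sum.inl z) (Sum.elim (fun z => Sum.inl (c z)) Sum.inr)
        have e1 : Holds p (φ.relabel k) ↔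
            φ.Realize (Sum.elim (fun z : A => (z : M)) (Sum.elim c b)) := by
          let k' : A ⊕ (γ ⊕ δ) → (A ∪ range c : Set M) ⊕ δ :=
            Sum.elim (fun z => Sum.inl ⟨z, Or.inl z.2⟩)
              (Sum.elim (fun z => Sum.inl ⟨c z, Or.inr ⟨z, rfl⟩⟩) Sum.inr)
          have := holds_tp (L := L) (A ∪ range c) b (φ.relabel k')
          rw [← hpb, holds_restrictParams, holds_relabel_relabel, Formula.realize_relabel] at this
          refine (iff_of_eq (congrArg (fun f => Holds p (φ.relabel f)) ?_)).trans
            (this.trans (iff_of_eq (congrArg _ ?_)))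
          · funext z
            rcases z with z | z | z <;> rfl
          · funext z
            rcases z with z | z | z <;> rfl
        have e2 : Holds p ((φ.relabel k).relabel (Sum.map σ id)) ↔
            φ.Realize (Sum.elim (fun z : A => (z : M)) (Sum.elim a d ∘ Sum.map g id)) := by
          let k' : A ⊕ (γ ⊕ δ) → (A ∪ range a' : Set M) ⊕ δ :=
            Sum.elim (fun z => Sum.inl ⟨z, Or.inl z.2⟩)
              (Sum.elim (fun z => Sum.inl ⟨a (g z), Or.inr ⟨⟨g z, hg z⟩, rfl⟩⟩) Sum.inr)
          have := holds_tp (L := L) (A ∪ range a') d (φ.relabel k')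
          rw [hd, holds_restrictParams, holds_relabel_relabel, Formula.realize_relabel] at this
          rw [holds_relabel_relabel]
          refine (iff_of_eq (congrArg (fun f => Holds p (φ.relabel f)) ?_)).trans
            (this.trans (iff_of_eq (congrArg _ ?_)))
          · funext z
            rcases z with z | z | z
            · exact congrArg Sum.inl (hσA z z.2)
            · exact congrArg Sum.inl (hσ z)
            · rfl
          · funext z
            rcases z with z | z | z <;> rfl
        rw [← e1, hp σ hσA, e2])
  refine ⟨Q', eq_of_forall_finset fun s => ?_, fun g hg => ?_⟩
  · rw [restrictVars_restrictVars]
    exact (hQ' s).1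
  · have := Fintype.ofFinite γ
    exact (hQ' (Finset.univ.image g)).2 g (fun c => by simp) hg

end Amalgamation

/-! ### Unavoidable formulas and reliability -/

section Forcing

variable {L : FirstOrder.Language.{u, v}} {M : Type w} [L.Structure M] [Nonempty M]
  {κ : Cardinal.{w}}

theorem InvIndep.mono {A : Set M} {α : Type x} {b : α → M} {C D : Set M} (h : C ⊆ D)
    (hb : InvIndep L A b D) : InvIndep L A b C := by
  obtain ⟨p, hp, hpb⟩ := hb
  exact ⟨p, hp, restrictParams_tp_mono (union_subset_union_right A h) hpb⟩

theorem InvIndep.comp {A : Set M} {α : Type x} {β : Type y} {b : β → M} {C : Set M} (f : α → β)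
    (hb : InvIndep L A b C) : InvIndep L A (b ∘ f) C := by
  obtain ⟨p, hp, hpb⟩ := hb
  refine ⟨restrictVars f p, hp.restrictVars f, ?_⟩
  rw [restrictParams_restrictVars, hpb, restrictVars_tp]

theorem IsInvariantSequence.comp {A : Set M} {n : ℕ} {α : Type x} {β : Type y}
    {b : Fin n → β → M} (f : α → β) (hb : IsInvariantSequence L A b) :
    IsInvariantSequence L A (fun i => b i ∘ f) := by
  refine ⟨fun i j => ?_, fun i => ((hb.2 i).comp f).mono ?_⟩
  · rw [← restrictVars_tp, ← restrictVars_tp, hb.1 i j]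
  · exact iUnion_mono fun j => range_comp_subset_range _ _

theorem IsInvariantSequence.init {A : Set M} {n : ℕ} {α : Type x} {b : Fin (n + 1) → α → M}
    (hb : IsInvariantSequence L A b) : IsInvariantSequence L A (fun i : Fin n => b i.castSucc) := by
  refine ⟨fun i j => hb.1 _ _, fun i => (hb.2 i.castSucc).mono ?_⟩
  refine iUnion_subset fun j => ?_
  exact subset_iUnion (fun j : {j : Fin (n + 1) // j < i.castSucc} => range (b j))
    ⟨j.1.castSucc, Fin.castSucc_lt_castSucc_iff.2 j.2⟩

theorem IsInvariantSequence.invIndep_last {A : Set M} {n : ℕ} {α : Type x}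
    {b : Fin (n + 1) → α → M} (hb : IsInvariantSequence L A b) :
    InvIndep L A (b (Fin.last n)) (range fun z : Fin n × α => b z.1.castSucc z.2) := by
  refine (hb.2 (Fin.last n)).mono ?_
  rintro _ ⟨⟨j, z⟩, rfl⟩
  exact mem_iUnion.2 ⟨⟨j.castSucc, Fin.castSucc_lt_last j⟩, z, rfl⟩

/-- The class `R` is closed under subtuples. -/
def ClosedUnderSubtuples (R : TypeClass L M) : Prop :=
  ∀ (α β : Type w) (f : α ↪ β), ∀ p ∈ R β, restrictVars f p ∈ R α

variable (L) in
/-- Every type over `A` extends to a type in `R`. -/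
def HasExtensions (A : Set M) (R : TypeClass L M) : Prop :=
  ∀ (α : Type w) (q : TypeOver L A α), ∃ p ∈ R α, restrictParams A p = q

/-- There is a type over `A` such that every extension of it in `R` contains an instance of `φ`
at some subtuple of variables with the type `q`. -/
def IsUnavoidable (A : Set M) (R : TypeClass L M) {m : ℕ} (q : TypeOver L A (Fin m))
    (φ : L.Formula (M ⊕ Fin m)) : Prop :=
  ∃ (β : Type w) (Q : TypeOver L A β), ∀ p ∈ R β, restrictParams A p = Q →
    ∃ g : Fin m ↪ β, restrictVars g Q = q ∧ Holds (restrictVars g p) φ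

/-- Induction on the length. The last term is to be an instance of `φ` in the type witnessing
unavoidability; attached to each candidate for it is a copy of the type that forces the earlier
terms, arranged so that the candidate is correctly placed over all possible choices of these. -/
theorem IsUnavoidable.exists_sequence (hM : IsMonster L M κ) {A : Set M} (hA : #A < κ)
    {R : TypeClass L M} (hR : ClosedUnderSubtuples R) (hex : HasExtensions L A R) {m : ℕ}
    {q : TypeOver L A (Fin m)} {φ : L.Formula (M ⊕ Fin m)} (hφ : IsUnavoidable A R q φ) {n : ℕ}
    {b : Fin (n + 1) → Fin m → M} (hb : IsInvariantSequence L A b) (hbq : tp L A (b 0) = q) :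
    ∃ (β : Type w) (Q : TypeOver L A β), ∀ p ∈ R β, restrictParams A p = Q →
      ∃ g : Fin (n + 1) × Fin m ↪ β, restrictVars g Q = tp L A (fun z => b z.1 z.2) ∧
        ∀ i, Holds (restrictVars (fun z => g (i, z)) p) φ := by
  induction n with
  | zero =>
    obtain ⟨β, Q, hQ⟩ := hφ
    refine ⟨β, Q, fun p hp hpQ => ?_⟩
    obtain ⟨g, hg, hgp⟩ := hQ p hp hpQ
    refine ⟨⟨fun z => g z.2, fun z z' h => Prod.ext (Fin.subsingleton_one.elim _ _) (g.injective h)⟩,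
      ?_, fun i => hgp⟩
    have h := congrArg (restrictVars (Prod.snd : Fin 1 × Fin m → Fin m)) hg
    rw [restrictVars_restrictVars, ← hbq, restrictVars_tp] at h
    refine h.trans (congrArg _ (funext fun z => ?_))
    rw [Fin.subsingleton_one.elim z.1 0]
    rfl
  | succ n ih =>
    obtain ⟨β₁, Q₁, hQ₁⟩ := ih hb.init hbq
    obtain ⟨Q₂, hQ₂, hQ₂b⟩ := exists_add_of_invIndep hM hA hb.invIndep_last Q₁
    -- The type of the added variables is known only relative to some copy of the earlier terms; one
    -- exists because `Q₁` has an extension in `R`.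
    have hinr : restrictVars Sum.inr Q₂ = q := by
      obtain ⟨p, hp, hpQ⟩ := hex β₁ Q₁
      obtain ⟨g, hg, -⟩ := hQ₁ p hp hpQ
      have h := congrArg (restrictVars Sum.inr) (hQ₂b g hg)
      rw [restrictVars_restrictVars, restrictVars_tp] at h
      exact h.trans ((hb.1 _ 0).trans hbq)
    obtain ⟨β₀, Q₀, hQ₀⟩ := hφ
    obtain ⟨V, i, Q', hQ', hattach⟩ := exists_attach hM hA Q₀ Q₂
      (⟨Sum.inr, Sum.inr_injective⟩ : Fin m ↪ β₁ ⊕ Fin m)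
    refine ⟨V, Q', fun p hp hpQ => ?_⟩
    -- The last term `g₀` is found first; the earlier terms `f` are then found in the copy of `Q₁`
    -- attached at `g₀`.
    obtain ⟨g₀, hg₀, hg₀p⟩ := hQ₀ (restrictVars i p) (hR _ _ i p hp) (by
      rw [restrictParams_restrictVars, hpQ, hQ'])
    obtain ⟨e, he, heQ⟩ := hattach g₀ (hg₀.trans hinr.symm)
    obtain ⟨f, hf, hfp⟩ := hQ₁ (restrictVars (e ∘ Sum.inl) p)
      (hR _ _ (Function.Embedding.trans ⟨Sum.inl, Sum.inl_injective⟩ e) p hp) (by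
        rw [restrictParams_restrictVars, hpQ, ← restrictVars_restrictVars, heQ, hQ₂])
    let t : Fin (n + 2) × Fin m → (Fin (n + 1) × Fin m) ⊕ Fin m := fun z =>
      Fin.lastCases (motive := fun _ => (Fin (n + 1) × Fin m) ⊕ Fin m)
        (Sum.inr z.2) (fun j => Sum.inl (j, z.2)) z.1
    have t_last : ∀ z, t (Fin.last _, z) = Sum.inr z := fun z => by simp [t]
    have t_castSucc : ∀ j z, t (Fin.castSucc j, z) = Sum.inl (j, z) := fun j z => by simp [t]
    have t_inj : Function.Injective t := by
      rintro ⟨j, z⟩ ⟨j', z'⟩ h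
      induction j using Fin.lastCases <;> induction j' using Fin.lastCases <;>
        simp_all
    refine ⟨⟨e ∘ Sum.map f id ∘ t, e.injective.comp
      ((Sum.map_injective.2 ⟨f.injective, Function.injective_id⟩).comp t_inj)⟩, ?_, fun j => ?_⟩
    · have h := congrArg (restrictVars t) (hQ₂b f hf)
      rw [restrictVars_restrictVars, ← heQ, restrictVars_restrictVars, restrictVars_tp] at h
      refine h.trans (congrArg _ (funext fun z => ?_))
      obtain ⟨j, z⟩ := z
      induction j using Fin.lastCases with
      | last => simp [t_last]
      | cast j => simp [t_castSucc]
    · induction j using Fin.lastCases with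
      | last =>
        rw [restrictVars_restrictVars] at hg₀p
        have h : (fun z => (e ∘ Sum.map f id ∘ t) (Fin.last (n + 1), z)) = i ∘ g₀ := by
          funext z
          simpa [t_last] using he z
        exact h ▸ hg₀p
      | cast j =>
        have h1 := hfp j
        rw [restrictVars_restrictVars] at h1
        have h : (fun z => (e ∘ Sum.map f id ∘ t) (Fin.castSucc j, z)) =
            (e ∘ Sum.inl) ∘ fun z => f (j, z) := by
          funext z
          simp [t_castSucc]
        exact h ▸ h1

/-- A class of types is reliable as soon as each formula in each of its types is unavoidable. -/
theorem isReliableClass_of_isUnavoidable (hM : IsMonster L M κ) {A : Set M} (hA : #A < κ)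
    {I R : TypeClass L M} (hRI : ∀ α, R α ⊆ I α) (hR : ClosedUnderSubtuples R)
    (hex : HasExtensions L A R)
    (hcl : ∀ (α : Type w) (q : TypeOver L A α), IsClosed {p | p ∈ R α ∧ restrictParams A p = q})
    (hun : ∀ (α : Type w), ∀ p ∈ R α, ∀ (m : ℕ) (e : Fin m ↪ α) (φ : L.Formula (M ⊕ Fin m)),
      Holds (restrictVars e p) φ → IsUnavoidable A R (restrictVars e (restrictParams A p)) φ) :
    IsReliableClass A I R := by
  refine ⟨hRI, hR, fun α β f p hp q hq => ?_, fun α n p hp q hq hs => ?_⟩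
  -- Since the members of `R` over `q` form a closed set, it suffices to treat one formula of `p` at
  -- a time.
  · obtain ⟨r, hr⟩ := exists_forall_holds_mem p
      (fun φ => {r : GlobalType L M β | (r ∈ R β ∧ restrictParams A r = q) ∧
        Holds (restrictVars f r) φ})
      (fun φ => (hcl β q).inter ((isClopen_setOf_holds φ).1.preimage (continuous_restrictVars f)))
      (fun φ ψ r hr => ⟨⟨hr.1, (holds_inf.1 hr.2).1⟩, ⟨hr.1, (holds_inf.1 hr.2).2⟩⟩) (by
        intro φ hφ
        obtain ⟨m, e, ψ, hψ⟩ := exists_fin_formula φ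
        obtain ⟨β₀, Q₀, hQ₀⟩ := hun α p hp m e ψ ((hψ p).2 hφ)
        obtain ⟨V, i, Q', hQ', hattach⟩ := exists_attach hM hA Q₀ q (e.trans f)
        obtain ⟨r, hr, hrQ⟩ := hex V Q'
        obtain ⟨g, hg, hgr⟩ := hQ₀ (restrictVars i r) (hR _ _ i r hr) (by
          rw [restrictParams_restrictVars, hrQ, hQ'])
        obtain ⟨e', he', he'Q⟩ := hattach g (by
          rw [hg, ← hq, restrictVars_restrictVars]
          rfl)
        refine ⟨restrictVars e' r, ⟨hR _ _ e' r hr, ?_⟩, ?_⟩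
        · rw [restrictParams_restrictVars, hrQ, he'Q]
        · rw [← hψ, restrictVars_restrictVars, restrictVars_restrictVars]
          rw [restrictVars_restrictVars] at hgr
          have h : e' ∘ f ∘ e = i ∘ g := funext he'
          rw [h]
          exact hgr)
    have hp0 : p = restrictVars f r := eq_of_forall_holds_imp fun φ hφ => (hr φ hφ).2
    obtain ⟨φ, hφ⟩ := exists_holds p
    exact ⟨r, (hr φ hφ).1.1, hp0.symm, (hr φ hφ).1.2⟩
  · obtain ⟨r, hr⟩ := exists_forall_holds_mem p
      (fun φ => {r : GlobalType L M (Fin (n + 1) × α) |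
        (r ∈ R (Fin (n + 1) × α) ∧ restrictParams A r = q) ∧
          ∀ i : Fin (n + 1), Holds (restrictVars (fun z => (i, z)) r) φ})
      (fun φ => (hcl _ q).inter (isClosed_ofPred_forall fun i =>
        (isClopen_setOf_holds φ).1.preimage (continuous_restrictVars _)))
      (fun φ ψ r hr => ⟨⟨hr.1, fun i => (holds_inf.1 (hr.2 i)).1⟩,
        ⟨hr.1, fun i => (holds_inf.1 (hr.2 i)).2⟩⟩) (by
        intro φ hφ
        classical
        obtain ⟨m, e, ψ, hψ⟩ := exists_fin_formula φ
        let s : Finset α := Finset.univ.map e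
        let e₀ : Fin m → s := fun j => ⟨e j, by simp [s]⟩
        -- Only the variables occurring in `φ` matter, and on this finite subtuple `q` is realized
        -- in `M` by an invariant sequence.
        obtain ⟨b₀, hb₀, hbq₀⟩ := hs s
        have hb : IsInvariantSequence L A (fun i => b₀ i ∘ e₀) := hb₀.comp e₀
        have hbq : tp L A (fun z : Fin (n + 1) × Fin m => b₀ z.1 (e₀ z.2)) =
            restrictVars (fun z : Fin (n + 1) × Fin m => (z.1, e z.2)) q := by
          have h := congrArg (restrictVars
            (fun z : Fin (n + 1) × Fin m => (z.1, e₀ z.2))) hbq₀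
          rwa [restrictVars_tp, restrictVars_restrictVars] at h
        have hb0 : tp L A (b₀ 0 ∘ e₀) = restrictVars e (restrictParams A p) := by
          have h := congrArg (restrictVars (fun z : Fin m => ((0 : Fin (n + 1)), z))) hbq
          rw [restrictVars_tp, restrictVars_restrictVars] at h
          rw [← hq, restrictVars_restrictVars]
          exact h
        obtain ⟨β₀, Q₀, hQ₀⟩ := (hun α p hp m e ψ ((hψ p).2 hφ)).exists_sequence hM hA hR hex hb hb0
        obtain ⟨V, i, Q', hQ', hattach⟩ := exists_attach hM hA Q₀ q
          ((Function.Embedding.refl (Fin (n + 1))).prodMap e)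
        obtain ⟨r, hr, hrQ⟩ := hex V Q'
        obtain ⟨g, hg, hgr⟩ := hQ₀ (restrictVars i r) (hR _ _ i r hr) (by
          rw [restrictParams_restrictVars, hrQ, hQ'])
        obtain ⟨e', he', he'Q⟩ := hattach g (hg.trans hbq)
        refine ⟨restrictVars e' r, ⟨hR _ _ e' r hr, ?_⟩, fun j => ?_⟩
        · rw [restrictParams_restrictVars, hrQ, he'Q]
        · rw [← hψ, restrictVars_restrictVars, restrictVars_restrictVars]
          have h1 := hgr j
          rw [restrictVars_restrictVars] at h1
          have h : e' ∘ (fun z => (j, z)) ∘ e = i ∘ fun z => g (j, z) :=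
            funext fun z => he' (j, z)
          rw [h]
          exact h1)
    obtain ⟨φ, hφ⟩ := exists_holds p
    exact ⟨r, (hr φ hφ).1.1, fun i => (eq_of_forall_holds_imp fun φ hφ => (hr φ hφ).2 i).symm,
      (hr φ hφ).1.2⟩

end Forcing

/-! ### Maximal sets of constraints -/

section Avoidance

variable {L : FirstOrder.Language.{u, v}} {M : Type w} [L.Structure M]

/-- The types in `I` that avoid all constraints in `F`. A constraint consists of a type `q` over `A`
and a formula `φ`; a type avoids it if `φ` does not hold at any subtuple of variables with the
type `q`. -/
def avoiding (A : Set M) (I : TypeClass L M)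
    (F : Set (Σ m : ℕ, TypeOver L A (Fin m) × L.Formula (M ⊕ Fin m))) : TypeClass L M :=
  fun α => {p | p ∈ I α ∧ ∀ k ∈ F, ∀ f : Fin k.1 ↪ α,
    restrictVars f (restrictParams A p) = k.2.1 → ¬ Holds (restrictVars f p) k.2.2}

/-- Fixing the restriction to `A` is essential: it decides which subtuples a constraint applies to,
and what remains is the failure of certain formulas, a closed condition. -/
theorem isClosed_avoiding {A : Set M} {I : TypeClass L M} (hI : ∀ α, IsClosed (I α))
    (F : Set (Σ m : ℕ, TypeOver L A (Fin m) × L.Formula (M ⊕ Fin m))) {α : Type w}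
    (q : TypeOver L A α) : IsClosed {p | p ∈ avoiding A I F α ∧ restrictParams A p = q} := by
  have h : {p | p ∈ avoiding A I F α ∧ restrictParams A p = q} =
      (I α ∩ {p | restrictParams A p = q}) ∩ {p : GlobalType L M α | ∀ k ∈ F, ∀ f : Fin k.1 ↪ α,
        restrictVars f q = k.2.1 → ¬ Holds (restrictVars f p) k.2.2} := by
    ext p
    refine ⟨fun ⟨⟨h1, h2⟩, h3⟩ => ⟨⟨h1, h3⟩, fun k hk f hf => h2 k hk f (h3 ▸ hf)⟩,
      fun ⟨⟨h1, h3⟩, h2⟩ => ⟨⟨h1, fun k hk f hf => h2 k hk f (h3 ▸ hf)⟩, h3⟩⟩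
  rw [h]
  refine ((hI α).inter (isClosed_singleton.preimage (continuous_restrictParams A))).inter ?_
  exact isClosed_ofPred_forall fun k => isClosed_ofPred_forall fun hk =>
    isClosed_ofPred_forall fun f => isClosed_ofPred_forall fun hf =>
      (isClopen_setOf_holds k.2.2).2.isClosed_compl.preimage (continuous_restrictVars f)

/-- If every type over `A` has an extension in `I`, then there is a maximal set of constraints that
can be avoided. -/
theorem exists_maximal_hasExtensions {A : Set M} {I : TypeClass L M}
    (hI : ∀ α, IsClosed (I α)) (hex : HasExtensions L A I) :
    ∃ F, Maximal (fun F => HasExtensions L A (avoiding A I F)) F := by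
  refine zorn_subset {F | HasExtensions L A (avoiding A I F)} fun c hc hchain => ?_
  rcases c.eq_empty_or_nonempty with rfl | hne
  · refine ⟨∅, fun α q => ?_, by simp⟩
    obtain ⟨p, hp, hpq⟩ := hex α q
    exact ⟨p, ⟨hp, by simp⟩, hpq⟩
  · refine ⟨⋃₀ c, fun α q => ?_, fun F hF => subset_sUnion_of_mem hF⟩
    have : Nonempty c := hne.to_subtype
    have hmono : ∀ F F' : Set _, F ⊆ F' → {p | p ∈ avoiding A I F' α ∧ restrictParams A p = q} ⊆
        {p | p ∈ avoiding A I F α ∧ restrictParams A p = q} :=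
      fun F F' h p hp => ⟨⟨hp.1.1, fun k hk => hp.1.2 k (h hk)⟩, hp.2⟩
    obtain ⟨p, hp⟩ := IsCompact.nonempty_iInter_of_directed_nonempty_isCompact_isClosed
      (fun F : c => {p | p ∈ avoiding A I F α ∧ restrictParams A p = q})
      (fun F F' => by
        rcases hchain.total F.2 F'.2 with h | h
        · exact ⟨F', hmono _ _ h, subset_rfl⟩
        · exact ⟨F, subset_rfl, hmono _ _ h⟩)
      (fun F => hc F.2 α q) (fun F => (isClosed_avoiding hI F q).isCompact)
      (fun F => isClosed_avoiding hI F q)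
    have hp' : ∀ F ∈ c, p ∈ avoiding A I F α ∧ restrictParams A p = q :=
      fun F hF => mem_iInter.1 hp ⟨F, hF⟩
    obtain ⟨F₀, hF₀⟩ := hne
    refine ⟨p, ⟨(hp' F₀ hF₀).1.1, ?_⟩, (hp' F₀ hF₀).2⟩
    rintro k ⟨F, hF, hk⟩
    exact (hp' F hF).1.2 k hk

variable [Nonempty M] {κ : Cardinal.{w}}

/-- The types avoiding a maximal set of constraints form a reliable class: a formula of such a type
that could be avoided would, by maximality, already give a constraint in the set. -/
theorem exists_reliably (hM : IsMonster L M κ) {A : Set M} (hA : #A < κ) {I : TypeClass L M}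
    (hI : ∀ α, IsClosed (I α)) (hR : ClosedUnderSubtuples I) (hex : HasExtensions L A I)
    (α : Type w) (q : TypeOver L A α) : ∃ p ∈ Reliably A I α, restrictParams A p = q := by
  obtain ⟨F, hF⟩ := exists_maximal_hasExtensions hI hex
  obtain ⟨p, hp, hpq⟩ := hF.1 α q
  refine ⟨p, ⟨avoiding A I F, ?_, hp⟩, hpq⟩
  refine isReliableClass_of_isUnavoidable hM hA (fun α p hp => hp.1) ?_ hF.1
    (fun α q => isClosed_avoiding hI F q) ?_
  · intro α β f p hp
    refine ⟨hR α β f p hp.1, fun k hk g hg => ?_⟩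
    rw [restrictParams_restrictVars, restrictVars_restrictVars] at hg
    rw [restrictVars_restrictVars]
    exact hp.2 k hk (g.trans f) hg
  · intro α p hp m e φ hφ
    by_contra hun
    let k : Σ m : ℕ, TypeOver L A (Fin m) × L.Formula (M ⊕ Fin m) :=
      ⟨m, restrictVars e (restrictParams A p), φ⟩
    have hins : HasExtensions L A (avoiding A I (insert k F)) := by
      intro β Q
      unfold IsUnavoidable at hun
      push Not at hun
      obtain ⟨r, hr, hrQ, hn⟩ := hun β Q
      refine ⟨r, ⟨hr.1, ?_⟩, hrQ⟩
      rintro k' (rfl | hk')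
      · intro g hg
        exact hn g (hrQ ▸ hg)
      · exact hr.2 k' hk'
    exact hp.2 k (hF.2 hins (subset_insert k F) (mem_insert k F)) e rfl hφ

end Avoidance

/-! ### Reliably invariant types are Kim-strictly invariant -/

section KimStrict

variable {L : FirstOrder.Language.{u, v}} {M : Type w} [L.Structure M]

theorem realize_equiv_comp (σ : M ≃[L] M) {V : Type*} (φ : L.Formula V) {a b : V → M}
    (h : ∀ z, σ (a z) = b z) : φ.Realize a ↔ φ.Realize b := by
  rw [← StrongHomClass.realize_formula σ φ (v := a)]
  exact iff_of_eq (congrArg _ (funext h))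

variable [Nonempty M] {κ : Cardinal.{w}}

theorem IsMorleySequence.isInvariantSequence {A : Set M} {β : Type x} {q : GlobalType L M β}
    (hq : IsInvariantOver A q) {e : ℕ → β → M} (he : IsMorleySequence A q e) (n : ℕ) :
    IsInvariantSequence L A (fun i : Fin n => e i) := by
  refine ⟨fun i j => (restrictParams_tp_mono subset_union_left (he i)).symm.trans
    (restrictParams_tp_mono subset_union_left (he j)), fun i => ?_⟩
  have h : InvIndep L A (e i) (⋃ j : {j : ℕ // j < i}, range (e j)) := ⟨q, hq, he i⟩
  refine h.mono (iUnion_subset fun j => ?_)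
  exact subset_iUnion (fun j : {j : ℕ // j < i} => range (e j)) ⟨j, j.2⟩

/-- Initial segments of a Morley sequence of an invariant type are invariant sequences. The sequence
property thus puts `ψ` at every term of a segment into one consistent type, with the same `b`
throughout. -/
theorem IsReliableClass.not_holds_of_kimDivides (hM : IsMonster L M κ) {A : Set M} (hA : #A < κ)
    {I R : TypeClass L M} (hR : IsReliableClass A I R) {k : ℕ} {γ : Type x}
    {ψ : L.Formula (γ ⊕ Fin k)} {d : Fin k → M} (hψ : KimDivides A ψ d)
    {r : GlobalType L M (ULift.{w} (Fin k))} (hr : r ∈ R _)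
    (hrd : restrictParams A r = tp L A (d ∘ ULift.down)) (b : γ → M) :
    ¬ Holds r (ψ.relabel (Sum.map b ULift.up)) := by
  intro h
  obtain ⟨q, hq, hqd, e, he, s, hs⟩ := hψ
  -- The first `n + 1` terms include all indices in `s`.
  let n := s.sup id
  let e' : Fin (n + 1) → ULift.{w} (Fin k) → M := fun i => e i ∘ ULift.down
  have he' : IsInvariantSequence L A e' := (he.isInvariantSequence hq (n + 1)).comp ULift.down
  obtain ⟨r', -, hr'r, hr'A⟩ := hR.sequence _ n r hr (tp L A fun z => e' z.1 z.2) (by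
    have h0 := congrArg (restrictVars (ULift.down : ULift.{w} (Fin k) → Fin k))
      ((restrictParams_tp_mono subset_union_left (he 0)).symm.trans hqd)
    rw [restrictVars_tp, restrictVars_tp] at h0
    rw [restrictVars_tp, hrd]
    exact h0) (isInvariantSequenceType_tp he')
  obtain ⟨c, hc, hcφ⟩ := exists_tp_eq_and_realize_iff hM hA r'
    fun i : Fin (n + 1) => ψ.relabel (Sum.map b fun j => (i, ULift.up j))
  obtain ⟨σ, hσA, hσ⟩ := exists_equiv_of_tp_eq hM hA (hc.trans hr'A)
  -- The realization `c` is only conjugate over `A` to the Morley sequence; moving it there carries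
  -- `b` to the common solution `σ ∘ b`.
  refine hs ⟨σ ∘ b, fun i hi => ?_⟩
  let i' : Fin (n + 1) := ⟨i, Nat.lt_succ_of_le (Finset.le_sup (f := id) hi)⟩
  have h1 : Holds r' (ψ.relabel (Sum.map b fun j => (i', ULift.up j))) := by
    rw [← hr'r i', holds_restrictVars, holds_relabel_relabel] at h
    refine (iff_of_eq (congrArg (fun f => Holds r' (ψ.relabel f)) ?_)).1 h
    funext z
    rcases z with z | z <;> rfl
  have h2 := (hcφ i').2 h1
  rw [Formula.realize_relabel] at h2
  refine (realize_equiv_comp σ ψ ?_).1 h2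
  rintro (z | z)
  · rfl
  · exact hσ (i', ULift.up z)

/-- A type in `R` extends in `R` to variables for the parameters of the Kim-dividing disjuncts. The
extension contains `φ` at `b` but none of the disjuncts, so they cannot cover `φ`. -/
theorem IsReliableClass.kimIndep (hM : IsMonster L M κ) {A : Set M} (hA : #A < κ)
    {I R : TypeClass L M} (hR : IsReliableClass A I R) {α : Type w} {p : GlobalType L M α}
    (hp : p ∈ R α) {β : Type x} {b : β → M} {a : α → M}
    (hpa : restrictParams (A ∪ range b) p = tp L (A ∪ range b) a) :
    KimIndep L A b (range a) := by
  classical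
  rintro m φ c hc hφ ⟨n, k, ψ, d, hdiv, himp⟩
  have hu : ∀ i, ∃ z : A ⊕ α, Sum.elim (fun z : A => (z : M)) a z = c i := by
    intro i
    rcases hc i with h | ⟨z, hz⟩
    · exact ⟨Sum.inl ⟨c i, h⟩, rfl⟩
    · exact ⟨Sum.inr z, hz⟩
  choose u hu using hu
  -- The finitely many coordinates of `a` used in `c`; the other entries of `c` come from `A`.
  let s : Finset α := (Finset.univ.image u).preimage Sum.inr Sum.inr_injective.injOn
  have hu' : ∀ i, ∃ z : A ⊕ s, Sum.map id (fun z : s => (z : α)) z = u i := by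
    intro i
    rcases h : u i with z | z
    · exact ⟨Sum.inl z, rfl⟩
    · exact ⟨Sum.inr ⟨z, by simp [s, ← h]⟩, rfl⟩
  choose u' hu' using hu'
  let d' : (Σ j : Fin n, Fin (k j)) → M := fun z => d z.1 z.2
  have hps : restrictVars (fun z : s => (z : α)) p ∈ R s :=
    hR.restrict s α (Function.Embedding.subtype _) p hp
  obtain ⟨r, hr, hrp, hrA⟩ := hR.extend s (s ⊕ (Σ j : Fin n, Fin (k j)))
    ⟨Sum.inl, Sum.inl_injective⟩ _ hps
    (tp L A (Sum.elim (fun z : s => a z) d')) (by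
      rw [restrictParams_restrictVars, restrictParams_tp_mono subset_union_left hpa,
        restrictVars_tp, restrictVars_tp]
      rfl)
  let Φ : Option (Fin n) → L.Formula (M ⊕ (s ⊕ (Σ j : Fin n, Fin (k j)))) := fun o =>
    o.elim (φ.relabel (Sum.elim (fun z => Sum.inl (b z))
      (fun i => Sum.map (fun z : A => (z : M)) Sum.inl (u' i))))
      fun j => (ψ j).relabel (Sum.map b fun i => Sum.inr ⟨j, i⟩)
  have h0 : Holds r (Φ none) := by
    let f : β ⊕ Fin m → (A ∪ range b : Set M) ⊕ α := Sum.elim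
      (fun z => Sum.inl ⟨b z, Or.inr ⟨z, rfl⟩⟩) fun i => Sum.map (fun z : A => ⟨z, Or.inl z.2⟩) id (u i)
    have h1 : Holds p (φ.relabel (Sum.map (fun z : (A ∪ range b : Set M) => (z : M)) id ∘ f)) := by
      rw [← holds_relabel_relabel, ← holds_restrictParams, hpa, holds_tp, Formula.realize_relabel]
      refine (iff_of_eq (congrArg _ ?_)).1 hφ
      funext z
      rcases z with z | i
      · rfl
      · simp only [Sum.elim_inr, Function.comp_apply, f, ← hu i]
        rcases u i with z | z <;> rfl
    have h2 : Holds (restrictVars (fun z : s => (z : α)) p) (φ.relabel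
        (Sum.elim (fun z => Sum.inl (b z)) fun i => Sum.map (fun z : A => (z : M)) id (u' i))) := by
      rw [holds_restrictVars, holds_relabel_relabel]
      refine (iff_of_eq (congrArg (fun f => Holds p (φ.relabel f)) ?_)).1 h1
      funext z
      rcases z with z | i
      · rfl
      · simp only [Sum.elim_inr, Function.comp_apply, f, ← hu' i]
        rcases u' i with z | z <;> rfl
    rw [← hrp, holds_restrictVars, holds_relabel_relabel] at h2
    refine (iff_of_eq (congrArg (fun f => Holds r (φ.relabel f)) ?_)).1 h2
    funext z
    rcases z with z | i
    · rfl
    · simp only [Sum.elim_inr, Function.comp_apply]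
      rcases u' i with z | z <;> rfl
  have hj : ∀ j, ¬ Holds r (Φ (some j)) := by
    intro j hj
    have hinj : Function.Injective (fun z : ULift.{w} (Fin (k j)) =>
        (Sum.inr ⟨j, z.down⟩ : s ⊕ (Σ j : Fin n, Fin (k j)))) := by
      intro z z' h
      exact ULift.ext _ _ (eq_of_heq (Sigma.mk.inj (Sum.inr_injective h)).2)
    refine hR.not_holds_of_kimDivides hM hA (hdiv j)
      (hR.restrict (ULift.{w} (Fin (k j))) _ ⟨_, hinj⟩ r hr) ?_ b ?_
    · rw [restrictParams_restrictVars, hrA, restrictVars_tp]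
      rfl
    · rw [holds_restrictVars, holds_relabel_relabel]
      refine (iff_of_eq (congrArg (fun f => Holds r ((ψ j).relabel f)) ?_)).1 hj
      funext z
      rcases z with z | z <;> rfl
  -- A tuple of `M` that agrees with `r` on `φ` and all `ψ j`. An automorphism over `A` takes it to
  -- the original parameters, and `b` to a solution of `φ` satisfying no `ψ j`.
  obtain ⟨c₀, hc₀, hΦ⟩ := exists_tp_eq_and_realize_iff hM hA r Φ
  obtain ⟨σ, hσA, hσ⟩ := exists_equiv_of_tp_eq hM hA (hc₀.trans hrA)
  have h1 := (hΦ none).2 h0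
  obtain ⟨j, hj'⟩ := himp (σ ∘ b) (by
    change (φ.relabel _).Realize _ at h1
    rw [Formula.realize_relabel] at h1
    refine (realize_equiv_comp σ φ ?_).1 h1
    rintro (z | i)
    · rfl
    · have hi := hu i
      rw [← hu' i] at hi
      change σ (Sum.elim id c₀ (Sum.map (fun z : A => (z : M)) Sum.inl (u' i))) = c i
      rw [← hi]
      rcases u' i with z | z
      · exact hσA z z.2
      · exact hσ (Sum.inl z))
  refine hj j ((hΦ (some j)).1 ?_)
  change ((ψ j).relabel _).Realize _
  rw [Formula.realize_relabel]
  refine (realize_equiv_comp σ (ψ j) ?_).2 hj'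
  rintro (z | i)
  · rfl
  · exact hσ (Sum.inr ⟨j, i⟩)

theorem IsReliablyInvariant.isKimStrictlyInvariant (hM : IsMonster L M κ) {A : Set M}
    (hA : #A < κ) {α : Type w} {p : GlobalType L M α} (hp : IsReliablyInvariant A p) :
    IsKimStrictlyInvariant A p := by
  obtain ⟨R, hR, hpR⟩ := hp
  exact ⟨hR.subset α hpR, fun β b a h => hR.kimIndep hM hA hpR h⟩

end KimStrict

/-! ### Invariant types and coheirs as classes -/

section Coheir

variable {L : FirstOrder.Language.{u, v}} {M : Type w} [L.Structure M]

theorem isClosed_setOf_isInvariantOver (A : Set M) (α : Type x) :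
    IsClosed {p : GlobalType L M α | IsInvariantOver A p} := by
  refine isClosed_ofPred_forall fun σ => isClosed_ofPred_forall fun _ =>
    isClosed_ofPred_forall fun φ => ?_
  have h1 := isClopen_setOf_holds (T := L.elementaryDiagram M) φ
  have h2 := isClopen_setOf_holds (T := L.elementaryDiagram M) (φ.relabel (Sum.map σ id))
  have h : {p : GlobalType L M α | Holds p φ ↔ Holds p (φ.relabel (Sum.map σ id))} =
      ({p : GlobalType L M α | Holds p φ}ᶜ ∪ {p | Holds p (φ.relabel (Sum.map σ id))}) ∩
        ({p : GlobalType L M α | Holds p (φ.relabel (Sum.map σ id))}ᶜ ∪ {p | Holds p φ}) := by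
    ext p
    simp only [mem_inter_iff, mem_union, mem_compl_iff, mem_ofPred_eq]
    tauto
  rw [h]
  exact ((h1.compl.union h2).inter (h2.compl.union h1)).1

theorem isClosed_setOf_isCoheir (A : Set M) (α : Type x) :
    IsClosed {p : GlobalType L M α | IsCoheir A p} := by
  refine isClosed_ofPred_forall fun φ => ?_
  by_cases h : ∃ a : α → M, (∀ i, a i ∈ A) ∧ φ.Realize (Sum.elim id a)
  · simp only [h, implies_true]
    exact isClosed_univ
  · simp only [h, imp_false]
    exact (isClopen_setOf_holds φ).2.isClosed_compl

/-- If a formula and its image under `σ` had different truth values in `p`, a tuple from `A` would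
witness the difference, but `σ` fixes that tuple. -/
theorem IsCoheir.isInvariantOver {A : Set M} {α : Type x} {p : GlobalType L M α}
    (hp : IsCoheir A p) : IsInvariantOver A p := by
  intro σ hσ φ
  have key : ∀ a : α → M, (∀ i, a i ∈ A) →
      ((φ.relabel (Sum.map σ id)).Realize (Sum.elim id a) ↔ φ.Realize (Sum.elim id a)) := by
    intro a ha
    rw [Formula.realize_relabel, ← StrongHomClass.realize_formula σ φ (v := Sum.elim id a)]
    refine iff_of_eq (congrArg _ ?_)
    funext z
    rcases z with z | z
    · rfl
    · exact (hσ _ (ha z)).symm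
  by_contra hne
  by_cases h1 : Holds p φ
  · have h2 : ¬ Holds p (φ.relabel (Sum.map σ id)) := fun h2 => hne (iff_of_true h1 h2)
    obtain ⟨a, ha, hr⟩ := hp _ (holds_inf.2 ⟨h1, holds_not.2 h2⟩)
    rw [Formula.realize_inf, Formula.realize_not, key a ha] at hr
    exact hr.2 hr.1
  · have h2 : Holds p (φ.relabel (Sum.map σ id)) := by
      by_contra h2
      exact hne (iff_of_false h1 h2)
    obtain ⟨a, ha, hr⟩ := hp _ (holds_inf.2 ⟨h2, holds_not.2 h1⟩)
    rw [Formula.realize_inf, Formula.realize_not, key a ha] at hr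
    exact hr.2 hr.1

theorem IsCoheir.restrictVars {A : Set M} {α : Type x} {β : Type y} (f : α → β)
    {p : GlobalType L M β} (hp : IsCoheir A p) : IsCoheir A (ReliableTypes.restrictVars f p) := by
  intro φ hφ
  rw [holds_restrictVars] at hφ
  obtain ⟨a, ha, hr⟩ := hp _ hφ
  refine ⟨a ∘ f, fun i => ha _, ?_⟩
  rw [Formula.realize_relabel] at hr
  refine (iff_of_eq (congrArg _ ?_)).1 hr
  funext z
  rcases z with z | z <;> rfl

variable [Nonempty M]

theorem holds_typeOf {α : Type x} (a : α → M) (φ : L.Formula (M ⊕ α)) :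
    Holds ((L.elementaryDiagram M).typeOf a) φ ↔ φ.Realize (Sum.elim id a) := by
  unfold Holds
  rw [CompleteType.formula_mem_typeOf]
  unfold Formula.Realize
  rw [← BoundedFormula.realize_constantsVarsEquiv, Equiv.apply_symm_apply]
  rfl

/-- By elementarity each formula of `q` is satisfied by a tuple from `N`, whose type over `M` is
trivially a coheir. Coheirs form a closed set, so compactness yields one containing all of `q`. -/
theorem exists_isCoheir (N : L.ElementarySubstructure M) {α : Type x}
    (q : TypeOver L (N : Set M) α) : ∃ p : GlobalType L M α,
      IsCoheir (N : Set M) p ∧ restrictParams (N : Set M) p = q := by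
  obtain ⟨p, hp⟩ := exists_forall_holds_mem q
    (fun φ => {p : GlobalType L M α | IsCoheir (N : Set M) p ∧
      Holds p (φ.relabel (Sum.map (fun c : (N : Set M) => (c : M)) id))})
    (fun φ => (isClosed_setOf_isCoheir _ _).inter (isClopen_setOf_holds _).1)
    (fun φ ψ p hp => by
      have : Holds p (φ.relabel (Sum.map (fun c : (N : Set M) => (c : M)) id) ⊓
          ψ.relabel (Sum.map (fun c : (N : Set M) => (c : M)) id)) := (holds_congr (by
        intro N _ a
        rw [Formula.realize_inf, Formula.realize_relabel, Formula.realize_relabel,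
          Formula.realize_relabel, Formula.realize_inf])).1 hp.2
      exact ⟨⟨hp.1, (holds_inf.1 this).1⟩, ⟨hp.1, (holds_inf.1 this).2⟩⟩) (by
      intro φ hφ
      obtain ⟨m, e, ψ, hψ⟩ := exists_fin_formula φ
      have h1 : Holds q ((Formula.iExs (Fin m) ψ).relabel Sum.inl) := by
        have h2 := (hψ q).2 hφ
        rw [holds_restrictVars] at h2
        obtain ⟨N', _, _, a, ha, -⟩ := exists_structure_holds_iff q
        rw [ha, Formula.realize_relabel] at h2
        rw [ha, Formula.realize_relabel, Formula.realize_iExs]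
        refine ⟨fun i => a (Sum.inr (e i)), (iff_of_eq (congrArg _ ?_)).1 h2⟩
        funext z
        rcases z with z | z <;> rfl
      rw [holds_relabel_inl] at h1
      have h2 : (Formula.iExs (Fin m) ψ).Realize (id : N → N) :=
        (N.subtype.map_formula (Formula.iExs (Fin m) ψ) id).1 h1
      rw [Formula.realize_iExs] at h2
      obtain ⟨c, hc⟩ := h2
      have : Nonempty N := inferInstance
      -- The remaining variables also need values in `N` for the type of `a` to be a coheir.
      let a : α → M := fun z => (Function.extend e c (fun _ => Classical.arbitrary N) z : N)
      have hae : a ∘ e = fun i => (c i : M) := by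
        funext i
        exact congrArg Subtype.val (e.injective.extend_apply c _ i)
      have h3 : Holds (tp L (N : Set M) a) φ := by
        rw [← hψ, restrictVars_tp, holds_tp, hae]
        refine (iff_of_eq (congrArg _ ?_)).1 ((N.subtype.map_formula ψ _).2 hc)
        funext z
        rcases z with z | z <;> rfl
      refine ⟨(L.elementaryDiagram M).typeOf a, fun θ hθ =>
        ⟨a, fun i => Subtype.property _, (holds_typeOf a θ).1 hθ⟩, ?_⟩
      rw [holds_typeOf, Formula.realize_relabel]
      rw [holds_tp] at h3
      refine (iff_of_eq (congrArg _ ?_)).1 h3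
      funext z
      rcases z with z | z <;> rfl)
  obtain ⟨φ₀, hφ₀⟩ := exists_holds q
  refine ⟨p, (hp φ₀ hφ₀).1, (eq_of_forall_holds_imp fun φ hφ => ?_).symm⟩
  rw [holds_restrictParams]
  exact (hp φ hφ).2

/-- The same class witnesses both: only its containment in the ambient class changes, and coheirs
are invariant. -/
theorem IsReliableCoheir.isReliablyInvariant {A : Set M} {α : Type w} {p : GlobalType L M α}
    (hp : IsReliableCoheir A p) : IsReliablyInvariant A p := by
  obtain ⟨R, hR, hpR⟩ := hp
  exact ⟨R, ⟨fun α p hp => IsCoheir.isInvariantOver (hR.subset α hp), hR.restrict, hR.extend,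
    hR.sequence⟩, hpR⟩

/-- A class of invariant types that is determined by restrictions to finitely many variables and
closed under renaming variables is closed under subtuples. -/
theorem closedUnderSubtuples_of_finset {A : Set M} {I : TypeClass L M}
    (hinv : ∀ (α : Type w), ∀ p ∈ I α, IsInvariantOver A p)
    (hren : ∀ (α β : Type w) (e : α ≃ β), ∀ p ∈ I β, restrictVars e p ∈ I α)
    (hfin : ∀ (α : Type w) (p : GlobalType L M α), IsInvariantOver A p →
      (p ∈ I α ↔ ∀ s : Finset α, restrictVars (fun z : s => (z : α)) p ∈ I s)) :
    ClosedUnderSubtuples I := by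
  intro α β f p hp
  rw [hfin α _ ((hinv β p hp).restrictVars f)]
  intro s
  have h1 := (hfin β p (hinv β p hp)).1 hp (s.map f)
  have h2 := hren s (s.map f : Finset β) (s.equivMap f) _ h1
  rw [restrictVars_restrictVars] at h2 ⊢
  exact h2

end Coheir

end ReliableTypes

theorem mainTheorem4 {L : FirstOrder.Language.{u, v}} {M : Type w} [L.Structure M] [Nonempty M]
    {κ : Cardinal.{w}} (hM : IsMonster L M κ) (A : Set M) (hA : #A < κ) :
    -- existence of types that are reliably in `I`
    (∀ I : TypeClass L M,
      (∀ (α : Type w), ∀ p ∈ I α, IsInvariantOver A p) →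
      (∀ (α : Type w) (q : TypeOver L A α), ∃ p ∈ I α, restrictParams A p = q) →
      (∀ α : Type w, IsClosed (I α)) →
      (∀ (α β : Type w) (e : α ≃ β), ∀ p ∈ I β, restrictVars e p ∈ I α) →
      (∀ (α : Type w) (p : GlobalType L M α), IsInvariantOver A p →
        (p ∈ I α ↔ ∀ s : Finset α, restrictVars (fun z : s => (z : α)) p ∈ I s)) →
      ∀ (α : Type w) (q : TypeOver L A α), ∃ p : GlobalType L M α,
        IsInvariantOver A p ∧ restrictParams A p = q ∧ p ∈ Reliably A I α) ∧
    -- reliably invariant types are Kim-strictly invariant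
    (∀ (α : Type w) (p : GlobalType L M α), IsReliablyInvariant A p → IsKimStrictlyInvariant A p) ∧
    -- existence of reliably invariant types over invariance bases
    (IsInvarianceBase L A → ∀ (α : Type w) (q : TypeOver L A α), ∃ p : GlobalType L M α,
      restrictParams A p = q ∧ IsReliablyInvariant A p ∧ IsKimStrictlyInvariant A p) ∧
    -- existence of reliable coheirs over models
    (∀ N : L.ElementarySubstructure M, (N : Set M) = A →
      ∀ (α : Type w) (q : TypeOver L A α), ∃ p : GlobalType L M α,
        restrictParams A p = q ∧ IsReliableCoheir A p ∧ IsKimStrictlyInvariant A p) := by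
  refine ⟨fun I hinv hex hcl hren hfin α q => ?_, fun α p hp => hp.isKimStrictlyInvariant hM hA,
    fun hbase α q => ?_, ?_⟩
  · obtain ⟨p, hp, hpq⟩ := exists_reliably hM hA hcl
      (closedUnderSubtuples_of_finset hinv hren hfin) hex α q
    exact ⟨p, hinv α p ((isGreatest_reliably A I).1.subset α hp), hpq, hp⟩
  · obtain ⟨p, hp, hpq⟩ := exists_reliably hM hA
      (I := fun _ => {p | IsInvariantOver A p}) (fun α => isClosed_setOf_isInvariantOver A α)
      (fun α β f p hp => IsInvariantOver.restrictVars f hp) hbase α q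
    exact ⟨p, hpq, hp, IsReliablyInvariant.isKimStrictlyInvariant hM hA hp⟩
  · rintro N rfl α q
    obtain ⟨p, hp, hpq⟩ := exists_reliably hM hA
      (I := fun _ => {p | IsCoheir (N : Set M) p}) (fun α => isClosed_setOf_isCoheir _ α)
      (fun α β f p hp => IsCoheir.restrictVars f hp) (fun α q => exists_isCoheir N q) α q
    exact ⟨p, hpq, hp, (IsReliableCoheir.isReliablyInvariant hp).isKimStrictlyInvariant hM hA⟩
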